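/- Let $k_2\ge 0$, $k_4>0$, $f_w>0$, $\sigma_w>0$, $P_a>0$, and let $h,\tilde h\in\mathbb C$ with $h\neq 0$. A complex random variable $X$ (the input) is sent over the channel $Y=hX+W$, where $W\sim\mathcal{CN}(0,\sigma_w^2)$ is independent of $X$. Let $I(X;Y)$ denote the mutual information, $P=\mathbb E|X|^2$, $Q=\mathbb E|X|^4$, and let $\mu_r,P_r,T_r,Q_r$ (resp. $\mu_i,P_i,T_i,Q_i$) be the moments of orders $1,2,3,4$ of $\Re X$ (resp. $\Im X$). The delivered power is $$P_{\rm del}=\alpha Q+\tilde\alpha\tilde Q+(\beta+\tilde\beta)P+\gamma,$$ $$\tilde Q=\tfrac13\big(Q_r+Q_i+2(\mu_rT_r+\mu_iT_i)+6P_rP_i+6P_r(P_r-\mu_r^2)+6P_i(P_i-\mu_i^2)\big),$$ with $\alpha=\frac{3k_4}{4f_w}|h|^4$, $\tilde\alpha=\frac{3k_4}{4f_w}|\tilde h|^4$, $\beta=\frac1{f_w}(k_2+6k_4\sigma_w^2)|h|^2$, $\tilde\beta=\frac1{f_w}(k_2+6k_4\sigma_w^2)|\tilde h|^2$, $\gamma=\frac1{f_w}(k_2\sigma_w^2+3k_4\sigma_w^4)$.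 Let $\mathcal F$ be a class of laws of $X$ with finite fourth moments that contains all Gaussian laws on $\mathbb C\cong\mathbb R^2$ (possibly degenerate) and whose members are determined by their first and second moments; of this determination only the following is needed: two members of $\mathcal F$ with the same first and second moments (including $\mathbb E[\Re X\,\Im X]$) have the same mixed moments $\mathbb E[(\Re X)^j(\Im X)^k]$ for $j+k\le 4$. For $P_d\in\mathbb R$ consider $$R(P_d)=\sup\{I(X;Y):\ \text{the law of }X\text{ is in }\mathcal F,\ P\le P_a,\ P_{\rm del}\ge P_d\}.$$ Write $G(P_r,P_i)$, for $P_r,P_i\ge 0$, for the law of $X$ with independent $\Re X\sim\mathcal N(0,P_r)$ and $\Im X\sim\mathcal N(0,P_i)$; call it optimal for $P_d$ if it satisfies the constraints and attains $R(P_d)$. Put $$P_{\rm dc,max}=3(\alpha+\tilde\alpha)P_a^2+(\beta+\tilde\beta)P_a+\gamma,\qquad P_{\rm dc,min}=2(\alpha+\tilde\alpha)P_a^2+(\beta+\tilde\beta)P_a+\gamma .$$ 1. For $G(P_r,P_i)$ one has $Q=\tilde Q=3(P_i^2+P_r^2)+2P_iP_r$. 2. For every $P_d\le P_{\rm dc,max}$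 there are $P_r,P_i\ge0$ with $P_r+P_i=P_a$ such that $G(P_r,P_i)$ is optimal for $P_d$. 3. $P_{\rm dc,max}$ is the maximum of $P_{\rm del}$ over all laws in $\mathcal F$ with $P\le P_a$. The values of $P_{\rm del}$ at $G(P_r,P_i)$ with $P_r,P_i\ge 0$, $P_r+P_i=P_a$, form exactly the interval $[P_{\rm dc,min},P_{\rm dc,max}]$; for these laws $P_{\rm del}=P_{\rm dc,max}$ iff $(P_r,P_i)\in\{(P_a,0),(0,P_a)\}$, and $P_{\rm del}=P_{\rm dc,min}$ iff $P_r=P_i=P_a/2$. 4. For $P_d=P_{\rm dc,max}$, $G(P_r,P_i)$ is optimal iff $(P_r,P_i)\in\{(P_a,0),(0,P_a)\}$. 5. For $P_d\le P_{\rm dc,min}$, $G(P_r,P_i)$ is optimal iff $P_r=P_i=P_a/2$ (so the delivered power is then $P_{\rm dc,min}$). 6. For $P_{\rm dc,min}<P_d<P_{\rm dc,max}$, $G(P_r,P_i)$ is optimal iff $P_r+P_i=P_a$ and $\alpha Q+\tilde\alpha\tilde Q+(\beta+\tilde\beta)P_a+\gamma=P_d$ with $Q,\tilde Q$ those of $G(P_r,P_i)$;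 moreover there is such an optimal split with $0<P_i<P_a/2$ and $P_r=P_a-P_i$ (an asymmetric one). 7. There is a tradeoff: $R$ is strictly decreasing on $[P_{\rm dc,min},P_{\rm dc,max}]$. -/

import Mathlib

open MeasureTheory ProbabilityTheory

noncomputable section

namespace SWIPT

/-- The mixed moment `E[Re(X)^j Im(X)^k]` of a complex input `X` with law `p`. -/
def moment (p : Measure ℂ) (j k : ℕ) : ℝ := ∫ x, x.re ^ j * x.im ^ k ∂p

/-- `P = E[|X|^2]`. -/
def inputPower (p : Measure ℂ) : ℝ := ∫ x, ‖x‖ ^ 2 ∂p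

/-- `Q = E[|X|^4]`. -/
def momentQ (p : Measure ℂ) : ℝ := ∫ x, ‖x‖ ^ 4 ∂p

/-- The quantity `Q̃`, in terms of `μ_r, T_r, P_r, Q_r` (moments of orders 1, 3, 2, 4 of the real
part) and of `μ_i, T_i, P_i, Q_i` (the same moments of the imaginary part). -/
def momentQt (p : Measure ℂ) : ℝ :=
  let μr := moment p 1 0
  let Pr := moment p 2 0
  let Tr := moment p 3 0
  let Qr := moment p 4 0
  let μi := moment p 0 1
  let Pi := moment p 0 2
  let Ti := moment p 0 3
  let Qi := moment p 0 4
  (1 / 3) * (Qr + Qi + 2 * (μr * Tr + μi * Ti)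
    + 6 * Pr * Pi + 6 * Pr * (Pr - μr ^ 2) + 6 * Pi * (Pi - μi ^ 2))

/-- The parameters of the system: the rectenna constants `k₂`, `k₄`, the bandwidth `fw`, the noise
standard deviation `σw`, and the channel gains `h` (even samples) and `h'` (odd samples; written
`h̃` in the mathematics). -/
structure System where
  k₂ : ℝ
  k₄ : ℝ
  fw : ℝ
  σw : ℝ
  h : ℂ
  h' : ℂ

namespace System

variable (S : System)

def α : ℝ := 3 * S.k₄ / (4 * S.fw) * ‖S.h‖ ^ 4

def α' : ℝ := 3 * S.k₄ / (4 * S.fw) * ‖S.h'‖ ^ 4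

def β : ℝ := 1 / S.fw * (S.k₂ + 6 * S.k₄ * S.σw ^ 2) * ‖S.h‖ ^ 2

def β' : ℝ := 1 / S.fw * (S.k₂ + 6 * S.k₄ * S.σw ^ 2) * ‖S.h'‖ ^ 2

def γ : ℝ := 1 / S.fw * (S.k₂ * S.σw ^ 2 + 3 * S.k₄ * S.σw ^ 4)

/-- The delivered power `P_del` for i.i.d. inputs with law `p`. -/
def deliveredPower (p : Measure ℂ) : ℝ :=
  S.α * momentQ p + S.α' * momentQt p + (S.β + S.β') * inputPower p + S.γ

/-- `P_dc,max` for the power budget `Pa`. -/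
def PdcMax (Pa : ℝ) : ℝ := 3 * (S.α + S.α') * Pa ^ 2 + (S.β + S.β') * Pa + S.γ

/-- `P_dc,min` for the power budget `Pa`. -/
def PdcMin (Pa : ℝ) : ℝ := 2 * (S.α + S.α') * Pa ^ 2 + (S.β + S.β') * Pa + S.γ

end System

/-- The law of a zero-mean complex Gaussian variable whose real and imaginary parts are independent,
with variances `Pr` and `Pi` (nonnegative; a zero variance gives a point mass at `0`). -/
def gaussianInput (Pr Pi : ℝ) : Measure ℂ :=
  ((gaussianReal 0 Pr.toNNReal).prod (gaussianReal 0 Pi.toNNReal)).map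
    (fun x : ℝ × ℝ => (⟨x.1, x.2⟩ : ℂ))

namespace System

variable (S : System)

/-- The law `CN(0, σw²)` of the noise `W`. -/
def noise : Measure ℂ := gaussianInput (S.σw ^ 2 / 2) (S.σw ^ 2 / 2)

/-- The joint law of `(X, Y)`, `Y = h X + W`, where `X` has law `p` and `W` is independent noise. -/
def jointLaw (p : Measure ℂ) : Measure (ℂ × ℂ) :=
  (p.prod S.noise).map (fun z : ℂ × ℂ => (z.1, S.h * z.1 + z.2))

/-- The mutual information `I(X; Y)` in nats: the relative entropy of the joint law of `(X, Y)`
with respect to the product of its marginals. -/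
def mutualInfo (p : Measure ℂ) : ENNReal :=
  InformationTheory.klDiv (S.jointLaw p) (p.prod (S.jointLaw p).snd)

/-- The laws in the class `F` that satisfy `P ≤ Pa` and `P_del ≥ Pd`. -/
def feasible (F : Set (Measure ℂ)) (Pa Pd : ℝ) : Set (Measure ℂ) :=
  {p | p ∈ F ∧ inputPower p ≤ Pa ∧ Pd ≤ S.deliveredPower p}

/-- The supremum of `I(X; Y)` over the feasible laws in the class `F`. -/
def optimalRate (F : Set (Measure ℂ)) (Pa Pd : ℝ) : ENNReal :=
  ⨆ p ∈ S.feasible F Pa Pd, S.mutualInfo p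

/-- `p` is feasible and attains the supremum. -/
def IsOptimal (F : Set (Measure ℂ)) (Pa Pd : ℝ) (p : Measure ℂ) : Prop :=
  p ∈ S.feasible F Pa Pd ∧ S.mutualInfo p = S.optimalRate F Pa Pd

end System

/-- `p` and `q` have the same mixed moments of all orders `1, …, n`. -/
def SameMoments (n : ℕ) (p q : Measure ℂ) : Prop :=
  ∀ j k : ℕ, j + k ≤ n → moment p j k = moment q j k

/-- A class of input laws, containing the Gaussian ones, whose members are determined by their first
and second moments. Determination is only asked for the moments up to order four, the statistics on
which the delivered power depends; it holds in particular if two members with the same first and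
second moments are equal, as for the class of all Gaussian laws. -/
structure SecondOrderClass (F : Set (Measure ℂ)) : Prop where
  /-- the members are probability measures -/
  isProbability : ∀ p ∈ F, IsProbabilityMeasure p
  /-- the members have finite fourth moments -/
  memLp : ∀ p ∈ F, MemLp (fun x : ℂ => x) 4 p
  /-- Gaussian laws on the plane (any mean and any covariance, also degenerate) are members -/
  gaussian_mem : ∀ p : Measure ℂ, IsGaussian p → p ∈ F
  /-- first and second moments determine the moments up to order four -/
  determined : ∀ p ∈ F, ∀ q ∈ F, SameMoments 2 p q → SameMoments 4 p q

end SWIPT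

end

/-!
The supremum over the class reduces to a one-parameter problem, the parameter being the product `D`
of two variances.

Every law `p` with finite second moments is the image of a centred law with uncorrelated real and
imaginary parts, of variances `a` and `b`, under a map `z ↦ u z + m` with `|u| = 1`
(`exists_isPrincipal`). For `p` in the class, the Gaussian law with the same `u`, `m`, `a`, `b` has
the same moments up to order four, hence the same delivered power, and the Gaussian moment formulas
show that neither `Q` nor `Q̃` exceeds `3 P² - 4 a b` (`momentQ_planarGaussian_le`,
`momentQt_planarGaussian_le`). Centred Gaussian inputs with independent coordinates attain this
value for both.

The mutual information of `p` is at most `½ log ((1 + ρ a) (1 + ρ b))`, where `ρ = |h|² / (σw² / 2)`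
(`System.mutualInfo_le`). By the chain rule for the relative entropy, replacing the output law in
`D(P_XY ‖ P_X ⊗ P_Y)` by any other law can only increase the divergence (`klDiv_prod_snd_le`).
With the Gaussian law matching the second moments of the output, the divergence is the expectation
of a difference of two quadratic log-densities, which is the stated value (`System.klDiv_jointLaw`).
For Gaussian inputs this Gaussian law is the output law itself, so the bound is an equality
(`System.mutualInfo_gaussianInput`).

With full power, the delivered power of a split of product `D = Pr Pi` is `PdcMax - 4 (α + α̃) D`,
decreasing in `D`, whereas the rate `½ log (1 + ρ Pa + ρ² D)` is increasing in `D`. Hence the optimum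
takes the largest product compatible with both `D ≤ Pa² / 4` and the delivery constraint
(`System.optimalRate_eq`, `System.isOptimal_gaussianInput_iff`), and the theorem
follows from the algebra of `Pr + Pi = Pa`, `Pr Pi = D`.
-/

noncomputable section

namespace SWIPT

open InformationTheory

/-! ### Moments of Gaussian variables -/

/-- The derivatives at `0` of the moment generating function of a centred Gaussian variable of
variance `v`. -/
lemma iteratedDeriv_exp_half_sq (v : ℝ) :
    iteratedDeriv 3 (fun t : ℝ => Real.exp (v * t ^ 2 / 2)) 0 = 0 ∧
      iteratedDeriv 4 (fun t : ℝ => Real.exp (v * t ^ 2 / 2)) 0 = 3 * v ^ 2 := by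
  have hE (t : ℝ) : HasDerivAt (fun t : ℝ => Real.exp (v * t ^ 2 / 2))
      (v * t * Real.exp (v * t ^ 2 / 2)) t := by
    have h : HasDerivAt (fun t : ℝ => v * t ^ 2 / 2) (v * t) t := by
      refine ((((hasDerivAt_id t).pow 2).const_mul v).div_const 2).congr_deriv ?_
      simp; ring
    exact h.exp.congr_deriv (by ring)
  have hP (p : ℝ → ℝ) (p' : ℝ → ℝ) (hp : ∀ t, HasDerivAt p (p' t) t) :
      deriv (fun t => p t * Real.exp (v * t ^ 2 / 2)) =
        fun t => (p' t + p t * (v * t)) * Real.exp (v * t ^ 2 / 2) := by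
    ext t
    rw [((hp t).fun_mul (hE t)).deriv]; ring
  have h1 : deriv (fun t : ℝ => Real.exp (v * t ^ 2 / 2)) =
      fun t => (v * t) * Real.exp (v * t ^ 2 / 2) := funext fun t => (hE t).deriv
  have h2 : deriv (fun t : ℝ => (v * t) * Real.exp (v * t ^ 2 / 2)) =
      fun t => (v + v ^ 2 * t ^ 2) * Real.exp (v * t ^ 2 / 2) := by
    rw [hP (fun t => v * t) (fun _ => v) fun t => by
      simpa using (hasDerivAt_id t).const_mul v]
    ext t; ring
  have h3 : deriv (fun t : ℝ => (v + v ^ 2 * t ^ 2) * Real.exp (v * t ^ 2 / 2)) =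
      fun t => (3 * v ^ 2 * t + v ^ 3 * t ^ 3) * Real.exp (v * t ^ 2 / 2) := by
    rw [hP (fun t => v + v ^ 2 * t ^ 2) (fun t => v ^ 2 * (2 * t)) fun t => by
      simpa using ((hasDerivAt_pow 2 t).const_mul (v ^ 2)).const_add v]
    ext t; ring
  have h4 : deriv (fun t : ℝ => (3 * v ^ 2 * t + v ^ 3 * t ^ 3) * Real.exp (v * t ^ 2 / 2)) =
      fun t => (3 * v ^ 2 + 6 * v ^ 3 * t ^ 2 + v ^ 4 * t ^ 4) * Real.exp (v * t ^ 2 / 2) := by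
    rw [hP (fun t => 3 * v ^ 2 * t + v ^ 3 * t ^ 3) (fun t => 3 * v ^ 2 + v ^ 3 * (3 * t ^ 2))
      fun t => by
        simpa using ((hasDerivAt_id t).const_mul (3 * v ^ 2)).fun_add
          ((hasDerivAt_pow 3 t).const_mul (v ^ 3))]
    ext t; ring
  simp only [iteratedDeriv_succ, iteratedDeriv_zero, h1, h2, h3, h4]
  simp

lemma integrable_pow_gaussianReal (m : ℝ) (v : NNReal) (n : ℕ) :
    Integrable (fun x : ℝ => x ^ n) (gaussianReal m v) := by
  have h := (memLp_id_gaussianReal' (μ := m) (v := v) n (by simp)).integrable_norm_pow'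
  rw [← integrable_norm_iff (by fun_prop)]
  simpa using h

lemma integral_pow_one_gaussianReal (m : ℝ) (v : NNReal) :
    ∫ x, x ^ 1 ∂gaussianReal m v = m := by simp

lemma integral_sq_gaussianReal (v : NNReal) : ∫ x, x ^ 2 ∂gaussianReal 0 v = v := by
  have h := variance_fun_id_gaussianReal (μ := 0) (v := v)
  rw [variance_eq_integral measurable_id'.aemeasurable] at h
  simpa using h

lemma integral_pow_three_gaussianReal (v : NNReal) : ∫ x, x ^ 3 ∂gaussianReal 0 v = 0 := by
  have h := iteratedDeriv_mgf_zero (X := fun x : ℝ => x) (μ := gaussianReal 0 v) (by simp) 3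
  rw [mgf_fun_id_gaussianReal] at h
  simp only [zero_mul, zero_add] at h
  rw [(iteratedDeriv_exp_half_sq v).1] at h
  simpa using h.symm

lemma integral_pow_four_gaussianReal (v : NNReal) :
    ∫ x, x ^ 4 ∂gaussianReal 0 v = 3 * (v : ℝ) ^ 2 := by
  have h := iteratedDeriv_mgf_zero (X := fun x : ℝ => x) (μ := gaussianReal 0 v) (by simp) 4
  rw [mgf_fun_id_gaussianReal] at h
  simp only [zero_mul, zero_add] at h
  rw [(iteratedDeriv_exp_half_sq v).2] at h
  simpa using h.symm

lemma integral_add_sq_gaussianReal (n : ℝ) (v : NNReal) :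
    ∫ x, (x + n) ^ 2 ∂gaussianReal 0 v = n ^ 2 + v := by
  have i1 := integrable_pow_gaussianReal 0 v 1
  have i2 := integrable_pow_gaussianReal 0 v 2
  have e (x : ℝ) : (x + n) ^ 2 = x ^ 2 + 2 * n * x ^ 1 + n ^ 2 := by ring
  simp only [e]
  rw [integral_add (by fun_prop) (by fun_prop), integral_add (by fun_prop) (by fun_prop),
    integral_const_mul, integral_sq_gaussianReal, integral_pow_one_gaussianReal]
  simp; ring

lemma integral_add_pow_three_gaussianReal (n : ℝ) (v : NNReal) :
    ∫ x, (x + n) ^ 3 ∂gaussianReal 0 v = n ^ 3 + 3 * n * v := by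
  have i1 := integrable_pow_gaussianReal 0 v 1
  have i2 := integrable_pow_gaussianReal 0 v 2
  have i3 := integrable_pow_gaussianReal 0 v 3
  have e (x : ℝ) : (x + n) ^ 3 = x ^ 3 + 3 * n * x ^ 2 + 3 * n ^ 2 * x ^ 1 + n ^ 3 := by ring
  simp only [e]
  rw [integral_add (by fun_prop) (by fun_prop), integral_add (by fun_prop) (by fun_prop),
    integral_add (by fun_prop) (by fun_prop),
    integral_const_mul, integral_const_mul, integral_sq_gaussianReal, integral_pow_one_gaussianReal,
    integral_pow_three_gaussianReal]
  simp; ring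

lemma integral_add_pow_four_gaussianReal (n : ℝ) (v : NNReal) :
    ∫ x, (x + n) ^ 4 ∂gaussianReal 0 v = n ^ 4 + 6 * n ^ 2 * v + 3 * (v : ℝ) ^ 2 := by
  have i1 := integrable_pow_gaussianReal 0 v 1
  have i2 := integrable_pow_gaussianReal 0 v 2
  have i3 := integrable_pow_gaussianReal 0 v 3
  have i4 := integrable_pow_gaussianReal 0 v 4
  have e (x : ℝ) : (x + n) ^ 4 =
    x ^ 4 + 4 * n * x ^ 3 + 6 * n ^ 2 * x ^ 2 + 4 * n ^ 3 * x ^ 1 + n ^ 4 := by ring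
  simp only [e]
  rw [integral_add (by fun_prop) (by fun_prop), integral_add (by fun_prop) (by fun_prop),
    integral_add (by fun_prop) (by fun_prop), integral_add (by fun_prop) (by fun_prop),
    integral_const_mul, integral_const_mul, integral_const_mul, integral_sq_gaussianReal,
    integral_pow_one_gaussianReal, integral_pow_three_gaussianReal, integral_pow_four_gaussianReal]
  simp; ring

lemma integral_gaussianInput {E : Type*} [NormedAddCommGroup E] [NormedSpace ℝ E] (a b : ℝ)
    (f : ℂ → E) :
    ∫ z, f z ∂gaussianInput a b =
      ∫ x : ℝ × ℝ, f ⟨x.1, x.2⟩ ∂(gaussianReal 0 a.toNNReal).prod (gaussianReal 0 b.toNNReal) := by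
  rw [gaussianInput]
  exact integral_map_equiv Complex.measurableEquivRealProd.symm f

lemma integrable_gaussianInput_iff {E : Type*} [NormedAddCommGroup E] (a b : ℝ) (f : ℂ → E) :
    Integrable f (gaussianInput a b) ↔ Integrable (fun x : ℝ × ℝ => f ⟨x.1, x.2⟩)
      ((gaussianReal 0 a.toNNReal).prod (gaussianReal 0 b.toNNReal)) := by
  rw [gaussianInput]
  exact integrable_map_equiv Complex.measurableEquivRealProd.symm f

lemma integral_mul_gaussianInput (a b : ℝ) (f g : ℝ → ℝ) :
    ∫ z, f z.re * g z.im ∂gaussianInput a b =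
      (∫ x, f x ∂gaussianReal 0 a.toNNReal) * ∫ x, g x ∂gaussianReal 0 b.toNNReal := by
  rw [integral_gaussianInput]
  exact integral_prod_mul f g

lemma integrable_mul_gaussianInput (a b : ℝ) {f g : ℝ → ℝ}
    (hf : Integrable f (gaussianReal 0 a.toNNReal))
    (hg : Integrable g (gaussianReal 0 b.toNNReal)) :
    Integrable (fun z : ℂ => f z.re * g z.im) (gaussianInput a b) := by
  rw [integrable_gaussianInput_iff]
  exact hf.mul_prod hg

instance isGaussian_gaussianInput (a b : ℝ) : IsGaussian (gaussianInput a b) := by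
  have : gaussianInput a b =
      ((gaussianReal 0 a.toNNReal).prod (gaussianReal 0 b.toNNReal)).map
        Complex.equivRealProdCLM.symm := by
    rw [gaussianInput]; congr 1
  rw [this]; infer_instance

/-- The Gaussian law with mean `m` whose principal axes are spanned by `u` and `i u`, with variances
`a` and `b` along them. Every Gaussian law on the plane is of this form. -/
def planarGaussian (u : Circle) (m : ℂ) (a b : ℝ) : Measure ℂ :=
  (gaussianInput a b).map (fun z => u * z + m)

instance isGaussian_planarGaussian (u : Circle) (m : ℂ) (a b : ℝ) :
    IsGaussian (planarGaussian u m a b) := by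
  have : planarGaussian u m a b = ((gaussianInput a b).map
      ((rotation u).toContinuousLinearEquiv)).map (fun x => x + m) := by
    rw [Measure.map_map (by fun_prop) (by fun_prop)]; rfl
  rw [this]; infer_instance

/-! ### Principal axes of a law on the plane -/

/-- The law `ν` is centred and its covariance matrix is diagonal with entries `a`, `b`: the real and
imaginary axes are principal axes. -/
structure IsPrincipal (ν : Measure ℂ) (a b : ℝ) : Prop where
  isProbability : IsProbabilityMeasure ν
  memLp : MemLp (fun x : ℂ => x) 2 ν
  re : ∫ x, x.re ∂ν = 0
  im : ∫ x, x.im ∂ν = 0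
  re_sq : ∫ x, x.re ^ 2 ∂ν = a
  im_sq : ∫ x, x.im ^ 2 ∂ν = b
  re_mul_im : ∫ x, x.re * x.im ∂ν = 0

namespace IsPrincipal
variable {ν : Measure ℂ} {a b : ℝ}

lemma nonneg_left (h : IsPrincipal ν a b) : 0 ≤ a :=
  h.re_sq ▸ integral_nonneg fun _ => sq_nonneg _

lemma nonneg_right (h : IsPrincipal ν a b) : 0 ≤ b :=
  h.im_sq ▸ integral_nonneg fun _ => sq_nonneg _

lemma memLp_re (h : IsPrincipal ν a b) : MemLp (fun x : ℂ => x.re) 2 ν := h.memLp.re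

lemma memLp_im (h : IsPrincipal ν a b) : MemLp (fun x : ℂ => x.im) 2 ν := h.memLp.im

lemma memLp_affine (h : IsPrincipal ν a b) (c d e : ℝ) :
    MemLp (fun x : ℂ => c * x.re + d * x.im + e) 2 ν := by
  have := h.isProbability
  exact ((h.memLp_re.const_mul c).add (h.memLp_im.const_mul d)).add (memLp_const e)

lemma integral_affine (h : IsPrincipal ν a b) (c d e : ℝ) :
    ∫ x, (c * x.re + d * x.im + e) ∂ν = e := by
  have := h.isProbability
  have i1 := h.memLp_re.integrable one_le_two
  have i2 := h.memLp_im.integrable one_le_two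
  rw [integral_add (by fun_prop) (by fun_prop), integral_add (by fun_prop) (by fun_prop),
    integral_const_mul, integral_const_mul, h.re, h.im]
  simp

lemma integral_affine_mul_affine (h : IsPrincipal ν a b) (c d e c' d' e' : ℝ) :
    ∫ x, (c * x.re + d * x.im + e) * (c' * x.re + d' * x.im + e') ∂ν =
      c * c' * a + d * d' * b + e * e' := by
  have := h.isProbability
  have i1 := h.memLp_re.integrable_sq
  have i2 := h.memLp_im.integrable_sq
  have i3 : Integrable (fun x : ℂ => x.re * x.im) ν := h.memLp_re.integrable_mul h.memLp_im
  have i4 : Integrable (fun x : ℂ => (c * e' + e * c') * x.re + (d * e' + e * d') * x.im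
      + e * e') ν := (h.memLp_affine _ _ _).integrable one_le_two
  have e (x : ℂ) : (c * x.re + d * x.im + e) * (c' * x.re + d' * x.im + e') =
      c * c' * x.re ^ 2 + d * d' * x.im ^ 2 + (c * d' + d * c') * (x.re * x.im) +
        ((c * e' + e * c') * x.re + (d * e' + e * d') * x.im + e * e') := by ring
  simp only [e]
  rw [integral_add (by fun_prop) i4, integral_add (by fun_prop) (by fun_prop),
    integral_add (by fun_prop) (by fun_prop), integral_const_mul, integral_const_mul,
    integral_const_mul, h.re_sq, h.im_sq, h.re_mul_im, h.integral_affine]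
  ring

end IsPrincipal

lemma isPrincipal_gaussianInput {a b : ℝ} (ha : 0 ≤ a) (hb : 0 ≤ b) :
    IsPrincipal (gaussianInput a b) a b where
  isProbability := inferInstance
  memLp := IsGaussian.memLp_two_id
  re := by simpa using integral_mul_gaussianInput a b (fun x => x) fun _ => 1
  im := by simpa using integral_mul_gaussianInput a b (fun _ => 1) fun x => x
  re_sq := by
    have h := integral_mul_gaussianInput a b (fun x => x ^ 2) fun _ => 1
    rw [integral_sq_gaussianReal] at h
    simpa [ha] using h
  im_sq := by
    have h := integral_mul_gaussianInput a b (fun _ => 1) fun x => x ^ 2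
    rw [integral_sq_gaussianReal] at h
    simpa [hb] using h
  re_mul_im := by simpa using integral_mul_gaussianInput a b (fun x => x) fun x => x

lemma normSq_circle (u : Circle) : (u : ℂ).re ^ 2 + (u : ℂ).im ^ 2 = 1 := by
  have := Circle.normSq_coe u
  rw [Complex.normSq_apply] at this; nlinarith

section Moments
variable {ν : Measure ℂ} {a b : ℝ}

/-- The moments of a rotated and translated law, as integrals of products of affine forms. -/
lemma moment_map (u : Circle) (m : ℂ) (j k : ℕ) :
    moment (ν.map fun z => u * z + m) j k =
      ∫ z : ℂ, ((u : ℂ).re * z.re + -(u : ℂ).im * z.im + m.re) ^ j *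
        ((u : ℂ).im * z.re + (u : ℂ).re * z.im + m.im) ^ k ∂ν := by
  rw [moment, integral_map (by fun_prop) (Continuous.aestronglyMeasurable (by fun_prop))]
  congr with z
  simp; ring

lemma IsPrincipal.sameMoments_two {ν' : Measure ℂ} (h : IsPrincipal ν a b)
    (h' : IsPrincipal ν' a b) (u : Circle) (m : ℂ) :
    SameMoments 2 (ν.map fun z => u * z + m) (ν'.map fun z => u * z + m) := by
  have := h.isProbability
  have := h'.isProbability
  intro j k hjk
  rw [moment_map, moment_map]
  have hj : j ≤ 2 := by omega
  have hk : k ≤ 2 := by omega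
  interval_cases j <;> interval_cases k <;> first | omega | skip
  all_goals simp only [pow_zero, pow_one, one_mul, mul_one, sq, h.integral_affine,
    h'.integral_affine, h.integral_affine_mul_affine, h'.integral_affine_mul_affine]
  simp

lemma IsPrincipal.moment_map (h : IsPrincipal ν a b) (u : Circle) (m : ℂ) :
    moment (ν.map fun z => u * z + m) 1 0 = m.re ∧
    moment (ν.map fun z => u * z + m) 0 1 = m.im ∧
    moment (ν.map fun z => u * z + m) 2 0 = (u : ℂ).re ^ 2 * a + (u : ℂ).im ^ 2 * b + m.re ^ 2 ∧
    moment (ν.map fun z => u * z + m) 0 2 =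
      (u : ℂ).im ^ 2 * a + (u : ℂ).re ^ 2 * b + m.im ^ 2 := by
  simp only [SWIPT.moment_map, pow_zero, pow_one, one_mul, mul_one, sq, h.integral_affine,
    h.integral_affine_mul_affine]
  simp

end Moments

/-- A symmetric `2 × 2` matrix, with `x` the difference of its diagonal entries and `y` its off-diagonal
entry, is diagonalized by a rotation; the angle is half the argument of `x + 2 i y`. -/
lemma exists_circle_mul_mul_eq_zero (x y : ℝ) :
    ∃ u : Circle, ((u : ℂ).re ^ 2 - (u : ℂ).im ^ 2) * y = (u : ℂ).re * (u : ℂ).im * x := by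
  refine ⟨Circle.exp (Complex.arg ⟨x, 2 * y⟩ / 2), ?_⟩
  set z : ℂ := ⟨x, 2 * y⟩
  have hx : x = ‖z‖ * Real.cos z.arg := (Complex.norm_mul_cos_arg z).symm
  have hy : 2 * y = ‖z‖ * Real.sin z.arg := (Complex.norm_mul_sin_arg z).symm
  have h1 : (Circle.exp (z.arg / 2) : ℂ).re = Real.cos (z.arg / 2) := by
    rw [Circle.coe_exp, Complex.exp_ofReal_mul_I_re]
  have h2 : (Circle.exp (z.arg / 2) : ℂ).im = Real.sin (z.arg / 2) := by
    rw [Circle.coe_exp, Complex.exp_ofReal_mul_I_im]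
  have h3 : Real.sin z.arg = 2 * Real.sin (z.arg / 2) * Real.cos (z.arg / 2) := by
    rw [← Real.sin_two_mul]; ring_nf
  have h4 : Real.cos z.arg = Real.cos (z.arg / 2) ^ 2 - Real.sin (z.arg / 2) ^ 2 := by
    rw [← Real.cos_two_mul']; ring_nf
  rw [h1, h2]
  rw [h3] at hy; rw [h4] at hx
  rw [hx, show y = ‖z‖ * Real.sin (z.arg / 2) * Real.cos (z.arg / 2) by linarith]
  ring

/-- Principal axes: centring `p` and rotating it makes the covariance matrix diagonal. -/
lemma exists_isPrincipal (p : Measure ℂ) [IsProbabilityMeasure p]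
    (hp : MemLp (fun x : ℂ => x) 2 p) :
    ∃ (ν : Measure ℂ) (u : Circle) (m : ℂ) (a b : ℝ), IsPrincipal ν a b ∧
      p = ν.map fun z => u * z + m := by
  set m : ℂ := ∫ x, x ∂p with hm
  have hi : Integrable (fun x : ℂ => x) p := hp.integrable one_le_two
  have hc : MemLp (fun x : ℂ => x - m) 2 p := hp.sub (memLp_const m)
  have hc0 : ∫ x, (x - m) ∂p = 0 := by
    rw [integral_sub hi (integrable_const _), integral_const]; simp [hm]
  have hr : MemLp (fun x : ℂ => (x - m).re) 2 p := hc.re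
  have hj : MemLp (fun x : ℂ => (x - m).im) 2 p := hc.im
  have i1 := hr.integrable_sq
  have i2 := hj.integrable_sq
  have i3 : Integrable (fun x : ℂ => (x - m).re * (x - m).im) p := hr.integrable_mul hj
  obtain ⟨u, hu⟩ := exists_circle_mul_mul_eq_zero
    ((∫ x, (x - m).re ^ 2 ∂p) - ∫ x, (x - m).im ^ 2 ∂p) (∫ x, (x - m).re * (x - m).im ∂p)
  have hmeas : Measurable fun x : ℂ => (starRingEnd ℂ) (u : ℂ) * (x - m) := by fun_prop
  have hcu : MemLp (fun x : ℂ => (starRingEnd ℂ) (u : ℂ) * (x - m)) 2 p := hc.const_mul _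
  have h0 : ∫ x, (starRingEnd ℂ) (u : ℂ) * (x - m) ∂p = 0 := by
    rw [integral_const_mul, hc0, mul_zero]
  have hic := hcu.integrable one_le_two
  refine ⟨p.map fun x => (starRingEnd ℂ) (u : ℂ) * (x - m), u, m, _, _,
    ⟨Measure.isProbabilityMeasure_map hmeas.aemeasurable, ?_, ?_, ?_, rfl, rfl, ?_⟩, ?_⟩
  · exact (memLp_map_measure_iff (by fun_prop) hmeas.aemeasurable).2 hcu
  · rw [integral_map hmeas.aemeasurable (Continuous.aestronglyMeasurable (by fun_prop))]
    have := integral_re hic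
    rw [h0] at this; simpa using this
  · rw [integral_map hmeas.aemeasurable (Continuous.aestronglyMeasurable (by fun_prop))]
    have := integral_im hic
    rw [h0] at this; simpa using this
  · rw [integral_map hmeas.aemeasurable (Continuous.aestronglyMeasurable (by fun_prop))]
    have e (x : ℂ) : ((starRingEnd ℂ) (u : ℂ) * (x - m)).re *
        ((starRingEnd ℂ) (u : ℂ) * (x - m)).im =
        ((u : ℂ).re ^ 2 - (u : ℂ).im ^ 2) * ((x - m).re * (x - m).im) +
          (u : ℂ).re * (u : ℂ).im * (x - m).im ^ 2 -
          (u : ℂ).re * (u : ℂ).im * (x - m).re ^ 2 := by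
      simp only [Complex.mul_re, Complex.mul_im, Complex.conj_re, Complex.conj_im]; ring
    simp only [e]
    have e3 : ∀ k : ℝ, Integrable (fun x : ℂ => k * ((x - m).re * (x - m).im)) p :=
      fun k => i3.const_mul k
    generalize (u : ℂ).re = c at *
    generalize (u : ℂ).im = s at *
    rw [integral_sub ((e3 _).fun_add (i2.const_mul _)) (i1.const_mul _),
      integral_add (e3 _) (i2.const_mul _),
      integral_const_mul, integral_const_mul, integral_const_mul]
    linarith
  · rw [Measure.map_map (by fun_prop) hmeas]
    have : ((fun z : ℂ => u * z + m) ∘ fun x => (starRingEnd ℂ) (u : ℂ) * (x - m)) = id := by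
      ext1 x
      simp only [Function.comp, ← mul_assoc, Complex.mul_conj, Circle.normSq_coe]
      simp
    rw [this, Measure.map_id]

/-! ### Relative entropy -/

lemma klDiv_withDensity_exp {Ω : Type*} [MeasurableSpace Ω] {μ ν : Measure Ω}
    [IsProbabilityMeasure μ] [IsProbabilityMeasure ν] {l : Ω → ℝ} (hl : Measurable l)
    (h : μ = ν.withDensity fun x => ENNReal.ofReal (Real.exp (l x))) (hi : Integrable l μ) :
    klDiv μ ν = ENNReal.ofReal (∫ x, l x ∂μ) := by
  have hac : μ ≪ ν := h ▸ withDensity_absolutelyContinuous _ _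
  have hll : llr μ ν =ᵐ[μ] l := by
    have : ∂μ/∂ν =ᵐ[ν] fun x => ENNReal.ofReal (Real.exp (l x)) := by
      conv_lhs => rw [h]
      exact Measure.rnDeriv_withDensity ν (by fun_prop)
    filter_upwards [hac.ae_le this] with x hx
    rw [llr, hx, ENNReal.toReal_ofReal (Real.exp_pos _).le, Real.log_exp]
  rw [klDiv_of_ac_of_integrable hac (hi.congr hll.symm), integral_congr_ae hll]
  simp

lemma klDiv_map_swap {Ω Ω' : Type*} [MeasurableSpace Ω] [MeasurableSpace Ω']
    (μ ν : Measure (Ω × Ω')) [IsFiniteMeasure μ] [IsFiniteMeasure ν] :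
    klDiv (μ.map Prod.swap) (ν.map Prod.swap) = klDiv μ ν := by
  refine le_antisymm (klDiv_map_le μ ν measurable_swap) ?_
  have h := klDiv_map_le (μ.map Prod.swap) (ν.map Prod.swap) measurable_swap
  rwa [Measure.map_map measurable_swap measurable_swap,
    Measure.map_map measurable_swap measurable_swap, Prod.swap_swap_eq, Measure.map_id,
    Measure.map_id] at h

/-- Among the laws `q` on the second factor, the divergence of `ρ` from `p ⊗ q` is smallest for the
second marginal of `ρ`: the excess is the divergence of this marginal from `q`, by the chain rule
applied to the disintegration of `ρ` along its second factor. -/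
lemma klDiv_prod_snd_le {Ω Ω' : Type*} [MeasurableSpace Ω] [StandardBorelSpace Ω] [Nonempty Ω]
    [MeasurableSpace Ω'] (ρ : Measure (Ω × Ω')) [IsProbabilityMeasure ρ]
    (p : Measure Ω) [IsProbabilityMeasure p] (q : Measure Ω') [IsProbabilityMeasure q] :
    klDiv ρ (p.prod ρ.snd) ≤ klDiv ρ (p.prod q) := by
  have hρ : IsProbabilityMeasure (ρ.map Prod.swap) :=
    Measure.isProbabilityMeasure_map measurable_swap.aemeasurable
  set κ := (ρ.map Prod.swap).condKernel
  have hκ : ρ.snd ⊗ₘ κ = ρ.map Prod.swap := by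
    rw [← Measure.fst_map_swap]; exact Measure.disintegrate _ _
  rw [← klDiv_map_swap ρ (p.prod ρ.snd), ← klDiv_map_swap ρ (p.prod q), Measure.prod_swap,
    Measure.prod_swap, ← hκ, ← Measure.compProd_const, ← Measure.compProd_const,
    klDiv_compProd_eq_add ρ.snd q]
  exact le_add_self

/-! ### Gaussian densities -/

/-- The density of `gaussianInput a b` with respect to Lebesgue measure, for positive `a` and `b`. -/
def gaussianDensity (a b : ℝ) (z : ℂ) : ℝ :=
  gaussianPDFReal 0 a.toNNReal z.re * gaussianPDFReal 0 b.toNNReal z.im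

@[fun_prop]
lemma measurable_gaussianDensity (a b : ℝ) : Measurable (gaussianDensity a b) := by
  unfold gaussianDensity; fun_prop

section Density
variable {a b : ℝ}

lemma gaussianDensity_pos (ha : 0 < a) (hb : 0 < b) (z : ℂ) : 0 < gaussianDensity a b z :=
  mul_pos (gaussianPDFReal_pos _ _ _ (by simpa using ha))
    (gaussianPDFReal_pos _ _ _ (by simpa using hb))

lemma log_gaussianDensity (ha : 0 < a) (hb : 0 < b) (z : ℂ) :
    Real.log (gaussianDensity a b z) =
      -(Real.log (2 * Real.pi) + Real.log (a * b) / 2) - (z.re ^ 2 / (2 * a) +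
        z.im ^ 2 / (2 * b)) := by
  have key {v : ℝ} (hv : 0 < v) (x : ℝ) : Real.log (gaussianPDFReal 0 v.toNNReal x) =
      -(Real.log (2 * Real.pi) + Real.log v) / 2 - x ^ 2 / (2 * v) := by
    rw [gaussianPDFReal, Real.log_mul (by positivity) (by positivity), Real.log_exp, Real.log_inv,
      Real.coe_toNNReal _ hv.le, Real.log_sqrt (by positivity),
      Real.log_mul (by positivity) (by positivity)]
    ring
  rw [gaussianDensity, Real.log_mul (gaussianPDFReal_pos _ _ _ (by simpa using ha)).ne'
    (gaussianPDFReal_pos _ _ _ (by simpa using hb)).ne', key ha, key hb,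
    Real.log_mul ha.ne' hb.ne']
  ring

lemma integrable_log_gaussianDensity {Ω : Type*} [MeasurableSpace Ω] {μ : Measure Ω}
    [IsProbabilityMeasure μ] (ha : 0 < a) (hb : 0 < b) {Z : Ω → ℂ} (hZ : MemLp Z 2 μ) :
    Integrable (fun ω => Real.log (gaussianDensity a b (Z ω))) μ := by
  have i1 : Integrable (fun ω => (Z ω).re ^ 2) μ := hZ.re.integrable_sq
  have i2 : Integrable (fun ω => (Z ω).im ^ 2) μ := hZ.im.integrable_sq
  simp only [log_gaussianDensity ha hb]
  fun_prop

/-- The expected log-density depends on `Z` only through its second moments; for matched variances it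
is minus the Gaussian entropy `log (2 π) + ½ log (a b) + 1`. -/
lemma integral_log_gaussianDensity {Ω : Type*} [MeasurableSpace Ω] {μ : Measure Ω}
    [IsProbabilityMeasure μ] (ha : 0 < a) (hb : 0 < b) {Z : Ω → ℂ} (hZ : MemLp Z 2 μ)
    (h1 : ∫ ω, (Z ω).re ^ 2 ∂μ = a) (h2 : ∫ ω, (Z ω).im ^ 2 ∂μ = b) :
    ∫ ω, Real.log (gaussianDensity a b (Z ω)) ∂μ =
      -(Real.log (2 * Real.pi) + Real.log (a * b) / 2 + 1) := by
  have i1 : Integrable (fun ω => (Z ω).re ^ 2) μ := hZ.re.integrable_sq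
  have i2 : Integrable (fun ω => (Z ω).im ^ 2) μ := hZ.im.integrable_sq
  simp only [log_gaussianDensity ha hb]
  rw [integral_sub (by fun_prop) (by fun_prop), integral_add (by fun_prop) (by fun_prop),
    integral_div, integral_div, h1, h2]
  simp
  field_simp
  ring

lemma lintegral_gaussianInput (ha : 0 < a) (hb : 0 < b) {f : ℂ → ENNReal} (hf : Measurable f) :
    ∫⁻ z, f z ∂gaussianInput a b = ∫⁻ z, ENNReal.ofReal (gaussianDensity a b z) * f z := by
  have hd : (gaussianReal 0 a.toNNReal).prod (gaussianReal 0 b.toNNReal) =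
      (volume : Measure (ℝ × ℝ)).withDensity fun x =>
        gaussianPDF 0 a.toNNReal x.1 * gaussianPDF 0 b.toNNReal x.2 := by
    rw [gaussianReal_of_var_ne_zero _ (by simpa using ha),
      gaussianReal_of_var_ne_zero _ (by simpa using hb),
      prod_withDensity (measurable_gaussianPDF _ _) (measurable_gaussianPDF _ _)]
    rfl
  have hm : Measurable fun x : ℝ × ℝ => (⟨x.1, x.2⟩ : ℂ) :=
    Complex.measurableEquivRealProd.symm.measurable
  rw [gaussianInput, lintegral_map hf hm, hd,
    lintegral_withDensity_eq_lintegral_mul _ (by fun_prop)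
      (show Measurable fun x : ℝ × ℝ => f ⟨x.1, x.2⟩ from hf.comp hm),
    ← Complex.volume_preserving_equiv_real_prod.symm.lintegral_comp
      (show Measurable fun z => ENNReal.ofReal (gaussianDensity a b z) * f z from
        (measurable_gaussianDensity a b).ennreal_ofReal.mul hf)]
  refine lintegral_congr fun x => ?_
  simp only [Pi.mul_apply, Complex.measurableEquivRealProd_symm_apply, gaussianDensity]
  rw [ENNReal.ofReal_mul (gaussianPDFReal_nonneg _ _ _)]
  rfl

lemma planarGaussian_eq_withDensity (u : Circle) (m : ℂ) (ha : 0 < a) (hb : 0 < b) :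
    planarGaussian u m a b = volume.withDensity fun y =>
      ENNReal.ofReal (gaussianDensity a b ((starRingEnd ℂ) (u : ℂ) * (y - m))) := by
  have hg := (measurable_gaussianDensity a b).ennreal_ofReal
  have hmul : Measurable fun y : ℂ => (starRingEnd ℂ) (u : ℂ) * (y - m) := by fun_prop
  refine Measure.ext_of_lintegral _ fun f hf => ?_
  have hd : Measurable fun y : ℂ =>
      ENNReal.ofReal (gaussianDensity a b ((starRingEnd ℂ) (u : ℂ) * (y - m))) := hg.comp hmul
  have hconj : (starRingEnd ℂ) (u : ℂ) * u = 1 := by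
    rw [mul_comm, Complex.mul_conj, Circle.normSq_coe, Complex.ofReal_one]
  rw [planarGaussian, lintegral_map hf (by fun_prop),
    lintegral_gaussianInput ha hb
      (show Measurable fun z : ℂ => f (u * z + m) from hf.comp (by fun_prop)),
    lintegral_withDensity_eq_lintegral_mul _ hd hf]
  symm
  rw [← lintegral_add_right_eq_self _ m]
  refine ((rotation u).measurePreserving.lintegral_comp
    ((hd.mul hf).comp (measurable_id.add_const m))).symm.trans ?_
  refine lintegral_congr fun x => ?_
  simp [rotation_apply, ← mul_assoc, hconj]

end Density

/-! ### Mutual information -/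

namespace System
variable (S : System)

instance isProbabilityMeasure_noise : IsProbabilityMeasure S.noise := by
  unfold noise; infer_instance

instance isProbabilityMeasure_jointLaw (p : Measure ℂ) [IsProbabilityMeasure p] :
    IsProbabilityMeasure (S.jointLaw p) :=
  Measure.isProbabilityMeasure_map (by fun_prop)

/-- The variance of each real coordinate of the noise. -/
def noiseVar : ℝ := S.σw ^ 2 / 2

/-- The likelihood ratio of the joint law and the product of `p` with a Gaussian law of the output is
the ratio of the density of the noise at `y - h x` and the density of the Gaussian law at `y`. -/
lemma jointLaw_eq_withDensity (hσ : 0 < S.noiseVar) (p : Measure ℂ) [IsProbabilityMeasure p]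
    (u : Circle) (m : ℂ) {A B : ℝ} (hA : 0 < A) (hB : 0 < B) :
    S.jointLaw p = (p.prod (planarGaussian u m A B)).withDensity fun z =>
      ENNReal.ofReal (Real.exp
        (Real.log (gaussianDensity S.noiseVar S.noiseVar (z.2 - S.h * z.1)) -
          Real.log (gaussianDensity A B ((starRingEnd ℂ) (u : ℂ) * (z.2 - m))))) := by
  have hN := measurable_gaussianDensity S.noiseVar S.noiseVar
  have hQ := measurable_gaussianDensity A B
  have m1 : Measurable fun z : ℂ × ℂ => gaussianDensity S.noiseVar S.noiseVar (z.2 - S.h * z.1) :=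
    hN.comp (by fun_prop)
  have m2 : Measurable fun y : ℂ => gaussianDensity A B ((starRingEnd ℂ) (u : ℂ) * (y - m)) :=
    hQ.comp (by fun_prop)
  have hσ' : 0 < S.σw ^ 2 / 2 := hσ
  rw [planarGaussian_eq_withDensity u m hA hB, prod_withDensity_right (by fun_prop),
    ← withDensity_mul _ (by fun_prop) (by fun_prop)]
  refine Measure.ext_of_lintegral _ fun f hf => ?_
  rw [lintegral_withDensity_eq_lintegral_mul _ (by fun_prop) hf,
    lintegral_prod _ (by fun_prop), jointLaw, lintegral_map hf (by fun_prop),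
    lintegral_prod _ (by fun_prop)]
  refine lintegral_congr fun x => ?_
  rw [noise, lintegral_gaussianInput hσ' hσ'
      (show Measurable fun w : ℂ => f (x, S.h * x + w) from hf.comp (by fun_prop)),
    ← lintegral_sub_right_eq_self _ (S.h * x)]
  refine lintegral_congr fun y => ?_
  have p1 := gaussianDensity_pos hσ hσ (y - S.h * x)
  have p2 := gaussianDensity_pos hA hB ((starRingEnd ℂ) (u : ℂ) * (y - m))
  simp only [Pi.mul_apply]
  rw [Real.exp_sub, Real.exp_log p1, Real.exp_log p2, ← ENNReal.ofReal_mul p2.le,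
    mul_div_cancel₀ _ p2.ne', add_sub_cancel]
  rfl

/-- The signal-to-noise ratio per unit of input variance in one real coordinate. -/
def snr : ℝ := ‖S.h‖ ^ 2 / S.noiseVar

/-- The phase of the channel gain `h`. -/
def phase : Circle := Circle.exp S.h.arg

lemma norm_mul_phase : (‖S.h‖ : ℂ) * S.phase = S.h := by
  rw [phase, Circle.coe_exp]; exact Complex.norm_mul_exp_arg_mul_I S.h

/-- The divergence of the joint law from the product of the input law with the Gaussian law that has
the mean and the covariance of the output. It depends on the input only through its covariance. -/
lemma klDiv_jointLaw (hσ : 0 < S.noiseVar) {ν : Measure ℂ} {a b : ℝ} (hν : IsPrincipal ν a b)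
    (u : Circle) (m : ℂ) :
    klDiv (S.jointLaw (ν.map fun z => u * z + m)) ((ν.map fun z => u * z + m).prod
      (planarGaussian (S.phase * u) (S.h * m) (‖S.h‖ ^ 2 * a + S.noiseVar)
        (‖S.h‖ ^ 2 * b + S.noiseVar))) =
      ENNReal.ofReal (Real.log ((1 + S.snr * a) * (1 + S.snr * b)) / 2) := by
  have := hν.isProbability
  have ha := hν.nonneg_left
  have hb := hν.nonneg_right
  set s := S.noiseVar with hs
  have hN : IsPrincipal S.noise s s := isPrincipal_gaussianInput hσ.le hσ.le
  have hA : 0 < ‖S.h‖ ^ 2 * a + s := by positivity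
  have hB : 0 < ‖S.h‖ ^ 2 * b + s := by positivity
  have hp : IsProbabilityMeasure (ν.map fun z => u * z + m) :=
    Measure.isProbabilityMeasure_map (by fun_prop)
  set w : Circle := S.phase * u with hw
  have hjoint : S.jointLaw (ν.map fun z => u * z + m) =
      (ν.prod S.noise).map fun z => (u * z.1 + m, S.h * (u * z.1 + m) + z.2) := by
    have h1 : (ν.map fun z => u * z + m).prod S.noise =
        (ν.prod S.noise).map fun z => (u * z.1 + m, z.2) := by
      have := Measure.map_prod_map ν S.noise (f := fun z : ℂ => u * z + m) (g := fun z => z)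
        (by fun_prop) (by fun_prop)
      rw [Measure.map_id'] at this
      rw [this]; rfl
    rw [jointLaw, h1, Measure.map_map (by fun_prop) (by fun_prop)]
    rfl
  have m1 : Measurable fun z : ℂ × ℂ => gaussianDensity s s (z.2 - S.h * z.1) :=
    (measurable_gaussianDensity _ _).comp (by fun_prop)
  have m2 : Measurable fun z : ℂ × ℂ => gaussianDensity (‖S.h‖ ^ 2 * a + s) (‖S.h‖ ^ 2 * b + s)
      ((starRingEnd ℂ) (w : ℂ) * (z.2 - S.h * m)) :=
    (measurable_gaussianDensity _ _).comp (by fun_prop)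
  -- in the coordinates of `ν`, the rotated output is the scaled input plus rotated noise
  have hw1 : (starRingEnd ℂ) (w : ℂ) * (S.h * u) = ‖S.h‖ := by
    have h1 : (starRingEnd ℂ) (w : ℂ) * w = 1 := by
      rw [mul_comm, Complex.mul_conj, Circle.normSq_coe, Complex.ofReal_one]
    calc (starRingEnd ℂ) (w : ℂ) * (S.h * u)
        = (starRingEnd ℂ) (w : ℂ) * ((‖S.h‖ * S.phase) * u) := by rw [norm_mul_phase]
      _ = ‖S.h‖ * ((starRingEnd ℂ) (w : ℂ) * w) := by rw [hw, Circle.coe_mul]; ring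
      _ = ‖S.h‖ := by rw [h1, mul_one]
  have hout (z : ℂ × ℂ) : (starRingEnd ℂ) (w : ℂ) * (S.h * (u * z.1 + m) + z.2 - S.h * m) =
      ‖S.h‖ * z.1 + (starRingEnd ℂ) (w : ℂ) * z.2 := by
    rw [← hw1]; ring
  have L1 : MemLp (fun z : ℂ × ℂ => z.2) 2 (ν.prod S.noise) := hN.memLp.comp_snd ν
  have L0 : MemLp (fun z : ℂ × ℂ => z.1) 2 (ν.prod S.noise) := hν.memLp.comp_fst S.noise
  have L2 : MemLp (fun z : ℂ × ℂ => ‖S.h‖ * z.1 + (starRingEnd ℂ) (w : ℂ) * z.2) 2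
      (ν.prod S.noise) := (L0.const_mul _).add (L1.const_mul _)
  -- the cross term vanishes by independence, the input coordinate being centred
  have hcross (f g : ℂ → ℝ) (hf : MemLp f 2 ν) (hg : MemLp g 2 S.noise)
      (hf0 : ∫ x, f x ∂ν = 0) :
      ∫ z, (f z.1 + g z.2) ^ 2 ∂ν.prod S.noise = ∫ x, f x ^ 2 ∂ν + ∫ y, g y ^ 2 ∂S.noise := by
    have j1 : Integrable (fun z : ℂ × ℂ => f z.1 ^ 2) (ν.prod S.noise) :=
      (hf.integrable_sq).comp_fst S.noise
    have j2 : Integrable (fun z : ℂ × ℂ => g z.2 ^ 2) (ν.prod S.noise) :=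
      (hg.integrable_sq).comp_snd ν
    have j3 : Integrable (fun z : ℂ × ℂ => f z.1 * g z.2) (ν.prod S.noise) :=
      (hf.integrable one_le_two).mul_prod (hg.integrable one_le_two)
    have e (z : ℂ × ℂ) : (f z.1 + g z.2) ^ 2 = f z.1 ^ 2 + 2 * (f z.1 * g z.2) + g z.2 ^ 2 := by
      ring
    simp only [e]
    rw [integral_add (by fun_prop) (by fun_prop), integral_add (by fun_prop) (by fun_prop),
      integral_const_mul, integral_prod_mul, hf0, integral_fun_fst (fun x => f x ^ 2),
      integral_fun_snd (fun x => g x ^ 2)]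
    simp
  have hw2 := normSq_circle w
  have v1 : ∫ z : ℂ × ℂ, ((‖S.h‖ * z.1 + (starRingEnd ℂ) (w : ℂ) * z.2 : ℂ)).re ^ 2
      ∂ν.prod S.noise = ‖S.h‖ ^ 2 * a + s := by
    have e (z : ℂ × ℂ) : ((‖S.h‖ * z.1 + (starRingEnd ℂ) (w : ℂ) * z.2 : ℂ)).re =
        (‖S.h‖ * z.1.re + 0 * z.1.im + 0) +
          ((w : ℂ).re * z.2.re + (w : ℂ).im * z.2.im + 0) := by simp
    simp only [e]
    rw [hcross _ _ (hν.memLp_affine _ _ _) (hN.memLp_affine _ _ _) (hν.integral_affine _ _ _)]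
    simp only [sq, hν.integral_affine_mul_affine, hN.integral_affine_mul_affine]
    linear_combination s * hw2
  have v2 : ∫ z : ℂ × ℂ, ((‖S.h‖ * z.1 + (starRingEnd ℂ) (w : ℂ) * z.2 : ℂ)).im ^ 2
      ∂ν.prod S.noise = ‖S.h‖ ^ 2 * b + s := by
    have e (z : ℂ × ℂ) : ((‖S.h‖ * z.1 + (starRingEnd ℂ) (w : ℂ) * z.2 : ℂ)).im =
        (0 * z.1.re + ‖S.h‖ * z.1.im + 0) +
          (-(w : ℂ).im * z.2.re + (w : ℂ).re * z.2.im + 0) := by simp; ring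
    simp only [e]
    rw [hcross _ _ (hν.memLp_affine _ _ _) (hN.memLp_affine _ _ _) (hν.integral_affine _ _ _)]
    simp only [sq, hν.integral_affine_mul_affine, hN.integral_affine_mul_affine]
    linear_combination s * hw2
  have w1 : ∫ z : ℂ × ℂ, z.2.re ^ 2 ∂ν.prod S.noise = s := by
    rw [integral_fun_snd (fun x : ℂ => x.re ^ 2), hN.re_sq]; simp
  have w2 : ∫ z : ℂ × ℂ, z.2.im ^ 2 ∂ν.prod S.noise = s := by
    rw [integral_fun_snd (fun x : ℂ => x.im ^ 2), hN.im_sq]; simp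
  have I1 := integrable_log_gaussianDensity hσ hσ L1
  have I2 := integrable_log_gaussianDensity hA hB L2
  rw [klDiv_withDensity_exp (by fun_prop)
    (S.jointLaw_eq_withDensity hσ (ν.map fun z => u * z + m) w (S.h * m) hA hB), hjoint,
    integral_map (by fun_prop) (by fun_prop)]
  · simp only [hout, add_sub_cancel_left]
    rw [integral_sub I1 I2, integral_log_gaussianDensity hσ hσ L1 w1 w2,
      integral_log_gaussianDensity hA hB L2 v1 v2]
    congr 1
    have e : (1 + S.snr * a) * (1 + S.snr * b) =
        (‖S.h‖ ^ 2 * a + s) * (‖S.h‖ ^ 2 * b + s) / (s * s) := by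
      rw [snr, ← hs]; field_simp; ring
    rw [e, Real.log_div (by positivity) (by positivity)]
    ring
  · rw [hjoint]
    refine (integrable_map_measure (by fun_prop) (by fun_prop)).2 ?_
    simp only [Function.comp_def, hout, add_sub_cancel_left]
    exact I1.sub I2

/-- The Gaussian bound on the mutual information of an arbitrary input with given covariance. -/
lemma mutualInfo_le (hσ : 0 < S.noiseVar) {ν : Measure ℂ} {a b : ℝ} (hν : IsPrincipal ν a b)
    (u : Circle) (m : ℂ) :
    S.mutualInfo (ν.map fun z => u * z + m) ≤
      ENNReal.ofReal (Real.log ((1 + S.snr * a) * (1 + S.snr * b)) / 2) := by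
  have := hν.isProbability
  have hp : IsProbabilityMeasure (ν.map fun z => u * z + m) :=
    Measure.isProbabilityMeasure_map (by fun_prop)
  rw [← S.klDiv_jointLaw hσ hν u m]
  exact klDiv_prod_snd_le _ _ _

end System

lemma charFun_gaussianInput {a b : ℝ} (ha : 0 ≤ a) (hb : 0 ≤ b) (t : ℂ) :
    charFun (gaussianInput a b) t =
      Complex.exp (-(a * t.re ^ 2 + b * t.im ^ 2 : ℝ) / 2) := by
  have e (x : ℝ × ℝ) : Complex.exp (inner ℝ (⟨x.1, x.2⟩ : ℂ) t * Complex.I) =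
      Complex.exp (t.re * x.1 * Complex.I) * Complex.exp (t.im * x.2 * Complex.I) := by
    rw [← Complex.exp_add, Complex.inner]
    simp; ring_nf
  rw [charFun_apply, integral_gaussianInput]
  simp only [e]
  rw [integral_prod_mul (fun x : ℝ => Complex.exp (t.re * x * Complex.I))
    (fun x : ℝ => Complex.exp (t.im * x * Complex.I)), ← charFun_apply_real, ← charFun_apply_real,
    charFun_gaussianReal, charFun_gaussianReal, ← Complex.exp_add]
  simp only [Real.coe_toNNReal _ ha, Real.coe_toNNReal _ hb]
  congr 1
  push_cast; ring

/-- The output of a centred Gaussian input is Gaussian; its principal axes are rotated by the phase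
of `h`. -/
lemma System.snd_jointLaw_gaussianInput (S : System) (hσ : 0 ≤ S.noiseVar) {a b : ℝ}
    (ha : 0 ≤ a) (hb : 0 ≤ b) :
    (S.jointLaw (gaussianInput a b)).snd =
      planarGaussian S.phase 0 (‖S.h‖ ^ 2 * a + S.noiseVar) (‖S.h‖ ^ 2 * b + S.noiseVar) := by
  refine Measure.ext_of_charFun (funext fun t => ?_)
  have hA : 0 ≤ ‖S.h‖ ^ 2 * a + S.noiseVar := by positivity
  have hB : 0 ≤ ‖S.h‖ ^ 2 * b + S.noiseVar := by positivity
  have e1 (z : ℂ × ℂ) : Complex.exp (inner ℝ (S.h * z.1 + z.2) t * Complex.I) =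
      Complex.exp (inner ℝ z.1 ((starRingEnd ℂ) S.h * t) * Complex.I) *
        Complex.exp (inner ℝ z.2 t * Complex.I) := by
    rw [← Complex.exp_add, Complex.inner, Complex.inner, Complex.inner]
    simp; ring_nf
  have e2 (z : ℂ) : inner ℝ ((S.phase : ℂ) * z + 0) t =
      inner ℝ z ((starRingEnd ℂ) (S.phase : ℂ) * t) := by
    rw [Complex.inner, Complex.inner]; simp; ring_nf
  rw [Measure.snd, jointLaw, Measure.map_map (by fun_prop) (by fun_prop), charFun_apply,
    integral_map (by fun_prop) (Continuous.aestronglyMeasurable (by fun_prop))]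
  simp only [Function.comp_def, e1]
  rw [integral_prod_mul (fun z : ℂ =>
      Complex.exp (inner ℝ z ((starRingEnd ℂ) S.h * t) * Complex.I))
    (fun z : ℂ => Complex.exp (inner ℝ z t * Complex.I)), ← charFun_apply, ← charFun_apply,
    charFun_apply (μ := planarGaussian _ _ _ _), planarGaussian,
    integral_map (by fun_prop) (Continuous.aestronglyMeasurable (by fun_prop))]
  simp only [e2]
  rw [← charFun_apply, charFun_gaussianInput ha hb, charFun_gaussianInput hA hB, noise,
    charFun_gaussianInput (show 0 ≤ S.σw ^ 2 / 2 from hσ) (show 0 ≤ S.σw ^ 2 / 2 from hσ),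
    ← Complex.exp_add]
  congr 1
  have h1 := normSq_circle S.phase
  have h2 := S.norm_mul_phase
  have hr : S.h.re = ‖S.h‖ * (S.phase : ℂ).re := by conv_lhs => rw [← h2]; simp
  have hi : S.h.im = ‖S.h‖ * (S.phase : ℂ).im := by conv_lhs => rw [← h2]; simp
  rw [← add_div]
  norm_cast
  congr 2
  simp only [Complex.mul_re, Complex.mul_im, Complex.conj_re, Complex.conj_im, hr, hi, noiseVar]
  linear_combination (S.σw ^ 2 / 2) * (t.re ^ 2 + t.im ^ 2) * h1

lemma planarGaussian_one_zero (a b : ℝ) : planarGaussian 1 0 a b = gaussianInput a b := by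
  simp [planarGaussian]

lemma System.mutualInfo_gaussianInput (S : System) (hσ : 0 < S.noiseVar) {a b : ℝ}
    (ha : 0 ≤ a) (hb : 0 ≤ b) :
    S.mutualInfo (gaussianInput a b) =
      ENNReal.ofReal (Real.log ((1 + S.snr * a) * (1 + S.snr * b)) / 2) := by
  have h := S.klDiv_jointLaw hσ (isPrincipal_gaussianInput ha hb) 1 0
  rw [← planarGaussian, planarGaussian_one_zero, mul_one, mul_zero,
    ← S.snd_jointLaw_gaussianInput hσ.le ha hb] at h
  exact h

/-! ### Delivered power -/

/-- The third and fourth moments of a linear functional of a Gaussian vector, in terms of its mean `m`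
and its variance `w`. -/
lemma gaussian_marginal (μ : Measure ℂ) [IsGaussian μ] (L : ℂ →L[ℝ] ℝ) {m w : ℝ}
    (h1 : ∫ z, L z ∂μ = m) (h2 : ∫ z, L z ^ 2 ∂μ = w + m ^ 2) :
    ∫ z, L z ^ 3 ∂μ = m ^ 3 + 3 * m * w ∧
      ∫ z, L z ^ 4 ∂μ = m ^ 4 + 6 * m ^ 2 * w + 3 * w ^ 2 := by
  have hv : Var[L; μ] = w := by
    rw [variance_eq_sub (IsGaussian.memLp_dual μ L 2 (by simp))]
    simp only [Pi.pow_apply, h1, h2]; ring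
  have hw : 0 ≤ w := hv ▸ variance_nonneg _ _
  have hmap : μ.map L = (gaussianReal 0 w.toNNReal).map (· + m) := by
    rw [IsGaussian.map_eq_gaussianReal L, h1, hv, gaussianReal_map_add_const, zero_add]
  have key (n : ℕ) : ∫ z, L z ^ n ∂μ = ∫ x, (x + m) ^ n ∂gaussianReal 0 w.toNNReal := by
    rw [← integral_map (φ := L) (f := fun x : ℝ => x ^ n) (by fun_prop) (by fun_prop), hmap,
      integral_map (by fun_prop) (by fun_prop)]
  rw [key, key, integral_add_pow_three_gaussianReal, integral_add_pow_four_gaussianReal,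
    Real.coe_toNNReal _ hw]
  exact ⟨rfl, rfl⟩

lemma inputPower_eq_moment {p : Measure ℂ} (hp : MemLp (fun x : ℂ => x) 2 p) :
    inputPower p = moment p 2 0 + moment p 0 2 := by
  have i1 : Integrable (fun x : ℂ => x.re ^ 2) p := hp.re.integrable_sq
  have i2 : Integrable (fun x : ℂ => x.im ^ 2) p := hp.im.integrable_sq
  have e (x : ℂ) : ‖x‖ ^ 2 = x.re ^ 2 + x.im ^ 2 := by
    rw [← Complex.normSq_eq_norm_sq, Complex.normSq_apply]; ring
  simp only [inputPower, moment, e, pow_zero, mul_one, one_mul]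
  exact integral_add i1 i2

lemma momentQ_eq_moment {p : Measure ℂ} (hp : MemLp (fun x : ℂ => x) 4 p) :
    momentQ p = moment p 4 0 + 2 * moment p 2 2 + moment p 0 4 := by
  have hn : Integrable (fun x : ℂ => ‖x‖ ^ 4) p := hp.integrable_norm_pow (p := 4) (by simp)
  have hb (j k : ℕ) (h : j + k = 4) : Integrable (fun x : ℂ => x.re ^ j * x.im ^ k) p := by
    refine hn.mono' (by fun_prop) (ae_of_all _ fun x => ?_)
    rw [norm_mul, norm_pow, norm_pow, ← h, pow_add]
    gcongr
    · exact Complex.abs_re_le_norm x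
    · exact Complex.abs_im_le_norm x
  have i1 := hb 4 0 rfl
  have i2 := hb 2 2 rfl
  have i3 := hb 0 4 rfl
  have e (x : ℂ) : ‖x‖ ^ 4 =
      x.re ^ 4 * x.im ^ 0 + 2 * (x.re ^ 2 * x.im ^ 2) + x.re ^ 0 * x.im ^ 4 := by
    have : ‖x‖ ^ 4 = (‖x‖ ^ 2) ^ 2 := by ring
    rw [this, ← Complex.normSq_eq_norm_sq, Complex.normSq_apply]; ring
  simp only [momentQ, moment, e]
  rw [integral_add (i1.fun_add (i2.const_mul _)) i3, integral_add i1 (i2.const_mul _),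
    integral_const_mul]

/-- Input power and delivered power depend only on the moments up to order four. -/
lemma SameMoments.deliveredPower_eq {p q : Measure ℂ} (h : SameMoments 4 p q)
    [IsProbabilityMeasure p] [IsProbabilityMeasure q]
    (hp : MemLp (fun x : ℂ => x) 4 p) (hq : MemLp (fun x : ℂ => x) 4 q) (S : System) :
    inputPower p = inputPower q ∧ S.deliveredPower p = S.deliveredPower q := by
  have hP : inputPower p = inputPower q := by
    rw [inputPower_eq_moment (hp.mono_exponent (by norm_num)),
      inputPower_eq_moment (hq.mono_exponent (by norm_num)), h 2 0 (by norm_num),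
      h 0 2 (by norm_num)]
  have hQ : momentQ p = momentQ q := by
    rw [momentQ_eq_moment hp, momentQ_eq_moment hq, h 4 0 le_rfl, h 0 4 le_rfl, h 2 2 le_rfl]
  have hQt : momentQt p = momentQt q := by
    simp only [momentQt]
    rw [h 1 0 (by norm_num), h 2 0 (by norm_num), h 3 0 (by norm_num), h 4 0 le_rfl,
      h 0 1 (by norm_num), h 0 2 (by norm_num), h 0 3 (by norm_num), h 0 4 le_rfl]
  exact ⟨hP, by rw [System.deliveredPower, System.deliveredPower, hP, hQ, hQt]⟩

section Planar
variable (u : Circle) (m : ℂ) {a b : ℝ}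

lemma memLp_planarGaussian (a b : ℝ) (n : ENNReal) (hn : n ≠ ⊤) :
    MemLp (fun x : ℂ => x) n (planarGaussian u m a b) := IsGaussian.memLp_id _ n hn

lemma inputPower_planarGaussian (ha : 0 ≤ a) (hb : 0 ≤ b) :
    inputPower (planarGaussian u m a b) = a + b + ‖m‖ ^ 2 := by
  obtain ⟨-, -, h20, h02⟩ := (isPrincipal_gaussianInput ha hb).moment_map u m
  rw [inputPower_eq_moment (memLp_planarGaussian u m a b 2 (by simp)), planarGaussian, h20, h02,
    ← Complex.normSq_eq_norm_sq, Complex.normSq_apply]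
  linear_combination (a + b) * normSq_circle u

lemma momentQt_planarGaussian (ha : 0 ≤ a) (hb : 0 ≤ b) :
    momentQt (planarGaussian u m a b) =
      3 * (a + b + ‖m‖ ^ 2) ^ 2
        - 4 * ((u : ℂ).re ^ 2 * a + (u : ℂ).im ^ 2 * b + m.re ^ 2) *
          ((u : ℂ).im ^ 2 * a + (u : ℂ).re ^ 2 * b + m.im ^ 2)
        - 2 * (m.re ^ 4 + m.im ^ 4) := by
  obtain ⟨h10, h01, h20, h02⟩ := (isPrincipal_gaussianInput ha hb).moment_map u m
  rw [← planarGaussian] at h10 h01 h20 h02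
  have hr := gaussian_marginal (planarGaussian u m a b) Complex.reCLM (m := m.re)
    (w := (u : ℂ).re ^ 2 * a + (u : ℂ).im ^ 2 * b)
    (by simpa [moment] using h10) (by simpa [moment] using h20)
  have hi := gaussian_marginal (planarGaussian u m a b) Complex.imCLM (m := m.im)
    (w := (u : ℂ).im ^ 2 * a + (u : ℂ).re ^ 2 * b)
    (by simpa [moment] using h01) (by simpa [moment] using h02)
  have h30 := (show moment (planarGaussian u m a b) 3 0 =
    ∫ z, Complex.reCLM z ^ 3 ∂planarGaussian u m a b by simp [moment]).trans hr.1
  have h40 := (show moment (planarGaussian u m a b) 4 0 =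
    ∫ z, Complex.reCLM z ^ 4 ∂planarGaussian u m a b by simp [moment]).trans hr.2
  have h03 := (show moment (planarGaussian u m a b) 0 3 =
    ∫ z, Complex.imCLM z ^ 3 ∂planarGaussian u m a b by simp [moment]).trans hi.1
  have h04 := (show moment (planarGaussian u m a b) 0 4 =
    ∫ z, Complex.imCLM z ^ 4 ∂planarGaussian u m a b by simp [moment]).trans hi.2
  have hab : a + b = ((u : ℂ).re ^ 2 * a + (u : ℂ).im ^ 2 * b) +
      ((u : ℂ).im ^ 2 * a + (u : ℂ).re ^ 2 * b) := by
    linear_combination -(a + b) * normSq_circle u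
  simp only [momentQt]
  rw [h10, h01, h20, h02, h30, h40, h03, h04, hab, ← Complex.normSq_eq_norm_sq,
    Complex.normSq_apply]
  ring

/-- `Q` is invariant under rotations, so it is computed along the principal axes, in which the
mean is some `n` with `|n| = |m|` and the coordinates are independent. -/
lemma momentQ_planarGaussian (ha : 0 ≤ a) (hb : 0 ≤ b) :
    ∃ n : ℂ, ‖n‖ = ‖m‖ ∧ momentQ (planarGaussian u m a b) =
      3 * (a + b + ‖m‖ ^ 2) ^ 2 - 4 * (a + n.re ^ 2) * (b + n.im ^ 2)
        - 2 * (n.re ^ 4 + n.im ^ 4) := by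
  refine ⟨(starRingEnd ℂ) (u : ℂ) * m,
    by rw [norm_mul, RCLike.norm_conj, Circle.norm_coe, one_mul], ?_⟩
  set n := (starRingEnd ℂ) (u : ℂ) * m with hn
  have hnm : ‖m‖ ^ 2 = n.re ^ 2 + n.im ^ 2 := by
    have : ‖m‖ = ‖n‖ := by rw [hn, norm_mul, RCLike.norm_conj, Circle.norm_coe, one_mul]
    rw [this, ← Complex.normSq_eq_norm_sq, Complex.normSq_apply]; ring
  have e (z : ℂ) : ‖u * z + m‖ ^ 4 = (z.re + n.re) ^ 4 * 1 +
      2 * ((z.re + n.re) ^ 2 * (z.im + n.im) ^ 2) + 1 * (z.im + n.im) ^ 4 := by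
    have h1 : u * z + m = u * (z + n) := by
      have : (u : ℂ) * n = m := by
        rw [hn, ← mul_assoc, Complex.mul_conj, Circle.normSq_coe]; simp
      rw [mul_add, this]
    have h2 : ‖z + n‖ ^ 4 = (‖z + n‖ ^ 2) ^ 2 := by ring
    rw [h1, norm_mul, Circle.norm_coe, one_mul, h2, ← Complex.normSq_eq_norm_sq,
      Complex.normSq_apply, Complex.add_re, Complex.add_im]
    ring
  have hint (k : ℝ) (v : NNReal) (i : ℕ) :
      Integrable (fun x : ℝ => (x + k) ^ i) (gaussianReal 0 v) := by
    have h := integrable_pow_gaussianReal k v i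
    rw [← zero_add k, ← gaussianReal_map_add_const, integrable_map_measure (by fun_prop)
      (by fun_prop)] at h
    simpa [Function.comp_def] using h
  have i1 : Integrable (fun z : ℂ => (z.re + n.re) ^ 4 * 1) (gaussianInput a b) :=
    integrable_mul_gaussianInput a b (hint n.re _ 4) (integrable_const (1 : ℝ))
  have i2 : Integrable (fun z : ℂ => (z.re + n.re) ^ 2 * (z.im + n.im) ^ 2) (gaussianInput a b) :=
    integrable_mul_gaussianInput a b (hint n.re _ 2) (hint n.im _ 2)
  have i3 : Integrable (fun z : ℂ => 1 * (z.im + n.im) ^ 4) (gaussianInput a b) :=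
    integrable_mul_gaussianInput a b (integrable_const (1 : ℝ)) (hint n.im _ 4)
  rw [momentQ, planarGaussian, integral_map (by fun_prop) (by fun_prop)]
  simp only [e]
  rw [integral_add (i1.fun_add (i2.const_mul _)) i3, integral_add i1 (i2.const_mul _),
    integral_const_mul,
    integral_mul_gaussianInput a b (fun x => (x + n.re) ^ 4) (fun _ => 1),
    integral_mul_gaussianInput a b (fun x => (x + n.re) ^ 2) (fun x => (x + n.im) ^ 2),
    integral_mul_gaussianInput a b (fun _ => 1) (fun x => (x + n.im) ^ 4),
    integral_add_pow_four_gaussianReal, integral_add_pow_four_gaussianReal,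
    integral_add_sq_gaussianReal, integral_add_sq_gaussianReal, Real.coe_toNNReal _ ha,
    Real.coe_toNNReal _ hb, hnm]
  simp
  ring

lemma momentQ_planarGaussian_le (ha : 0 ≤ a) (hb : 0 ≤ b) :
    momentQ (planarGaussian u m a b) ≤ 3 * (a + b + ‖m‖ ^ 2) ^ 2 - 4 * (a * b) := by
  obtain ⟨n, -, h⟩ := momentQ_planarGaussian u m ha hb
  rw [h]
  have h1 : 0 ≤ a * n.im ^ 2 := by positivity
  have h2 : 0 ≤ b * n.re ^ 2 := by positivity
  have h3 : 0 ≤ n.re ^ 2 * n.im ^ 2 := by positivity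
  have h4 : 0 ≤ n.re ^ 4 + n.im ^ 4 := by positivity
  linarith

lemma momentQt_planarGaussian_le (ha : 0 ≤ a) (hb : 0 ≤ b) :
    momentQt (planarGaussian u m a b) ≤ 3 * (a + b + ‖m‖ ^ 2) ^ 2 - 4 * (a * b) := by
  rw [momentQt_planarGaussian u m ha hb]
  have hu := normSq_circle u
  generalize (u : ℂ).re = c at *
  generalize (u : ℂ).im = s at *
  -- the product of the coordinate variances dominates the determinant of the covariance
  have h0 : (c ^ 2 * a + s ^ 2 * b) * (s ^ 2 * a + c ^ 2 * b) =
      a * b * (c ^ 2 + s ^ 2) ^ 2 + (c * s * (a - b)) ^ 2 := by ring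
  rw [hu] at h0
  have h1 : 0 ≤ (c ^ 2 * a + s ^ 2 * b) * m.im ^ 2 := by positivity
  have h2 : 0 ≤ (s ^ 2 * a + c ^ 2 * b) * m.re ^ 2 := by positivity
  have h3 : 0 ≤ m.re ^ 2 * m.im ^ 2 := by positivity
  have h4 : 0 ≤ m.re ^ 4 + m.im ^ 4 := by positivity
  have h5 : 0 ≤ (c * s * (a - b)) ^ 2 := sq_nonneg _
  linarith

end Planar

section GaussianInput
variable {a b : ℝ}

lemma inputPower_gaussianInput (ha : 0 ≤ a) (hb : 0 ≤ b) :
    inputPower (gaussianInput a b) = a + b := by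
  rw [← planarGaussian_one_zero, inputPower_planarGaussian 1 0 ha hb]; simp

lemma momentQ_gaussianInput (ha : 0 ≤ a) (hb : 0 ≤ b) :
    momentQ (gaussianInput a b) = 3 * (a + b) ^ 2 - 4 * (a * b) := by
  obtain ⟨n, hn, h⟩ := momentQ_planarGaussian 1 0 ha hb
  rw [norm_zero, norm_eq_zero] at hn
  rw [← planarGaussian_one_zero, h, hn]; simp; ring

lemma momentQt_gaussianInput (ha : 0 ≤ a) (hb : 0 ≤ b) :
    momentQt (gaussianInput a b) = 3 * (a + b) ^ 2 - 4 * (a * b) := by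
  rw [← planarGaussian_one_zero, momentQt_planarGaussian 1 0 ha hb]; simp; ring

end GaussianInput

namespace System
variable (S : System)

lemma deliveredPower_gaussianInput {a b : ℝ} (ha : 0 ≤ a) (hb : 0 ≤ b) :
    S.deliveredPower (gaussianInput a b) =
      (S.α + S.α') * (3 * (a + b) ^ 2 - 4 * (a * b)) + (S.β + S.β') * (a + b) + S.γ := by
  rw [deliveredPower, momentQ_gaussianInput ha hb, momentQt_gaussianInput ha hb,
    inputPower_gaussianInput ha hb]
  ring

lemma gaussianInput_mem {F : Set (Measure ℂ)} (hF : SecondOrderClass F) (a b : ℝ) :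
    gaussianInput a b ∈ F := hF.gaussian_mem _ inferInstance

/-- The reduction to two variances: the rate and the delivered power of a member of the class are
bounded by expressions in its power and in the variances `a`, `b` along its principal axes. -/
lemma exists_bounds (hσ : 0 < S.noiseVar) (hα : 0 ≤ S.α) (hα' : 0 ≤ S.α')
    {F : Set (Measure ℂ)} (hF : SecondOrderClass F) {p : Measure ℂ} (hp : p ∈ F) :
    ∃ a b : ℝ, 0 ≤ a ∧ 0 ≤ b ∧ a + b ≤ inputPower p ∧
      S.deliveredPower p ≤ (S.α + S.α') * (3 * inputPower p ^ 2 - 4 * (a * b)) +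
        (S.β + S.β') * inputPower p + S.γ ∧
      S.mutualInfo p ≤ ENNReal.ofReal (Real.log ((1 + S.snr * a) * (1 + S.snr * b)) / 2) := by
  have := hF.isProbability p hp
  have hp4 := hF.memLp p hp
  obtain ⟨ν, u, m, a, b, hν, hpν⟩ := exists_isPrincipal p (hp4.mono_exponent (by norm_num))
  have ha := hν.nonneg_left
  have hb := hν.nonneg_right
  have h2 : SameMoments 2 p (planarGaussian u m a b) := by
    rw [hpν]; exact hν.sameMoments_two (isPrincipal_gaussianInput ha hb) u m
  have h4 := hF.determined p hp _ (hF.gaussian_mem _ inferInstance) h2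
  obtain ⟨hP, hD⟩ := h4.deliveredPower_eq hp4 (memLp_planarGaussian u m a b 4 (by simp)) S
  have hPm := inputPower_planarGaussian u m ha hb
  refine ⟨a, b, ha, hb, ?_, ?_, hpν ▸ S.mutualInfo_le hσ hν u m⟩
  · rw [hP, hPm]; linarith [sq_nonneg ‖m‖]
  · rw [hD, hP, deliveredPower]
    have q1 := mul_le_mul_of_nonneg_left (momentQ_planarGaussian_le u m ha hb) hα
    have q2 := mul_le_mul_of_nonneg_left (momentQt_planarGaussian_le u m ha hb) hα'
    rw [← hPm] at q1 q2
    linarith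

/-! ### The optimization over the variances -/

/-- The rate at full power `Pa` when the two variances have product `D`. -/
def rate (Pa D : ℝ) : ENNReal :=
  ENNReal.ofReal (Real.log (1 + S.snr * Pa + S.snr ^ 2 * D) / 2)

variable {S}

lemma log_div_two_lt {x y : ℝ} (hx : 1 ≤ x) (hxy : x < y) :
    ENNReal.ofReal (Real.log x / 2) < ENNReal.ofReal (Real.log y / 2) := by
  refine (ENNReal.ofReal_lt_ofReal_iff ?_).2 ?_
  · have := Real.log_pos (hx.trans_lt hxy); linarith
  · have := Real.log_lt_log (by linarith) hxy; linarith

lemma log_div_two_le {x y : ℝ} (hx : 1 ≤ x) (hxy : x ≤ y) :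
    ENNReal.ofReal (Real.log x / 2) ≤ ENNReal.ofReal (Real.log y / 2) := by
  refine ENNReal.ofReal_le_ofReal ?_
  have := Real.log_le_log (by linarith) hxy; linarith

lemma rate_strictMonoOn (hρ : 0 < S.snr) {Pa : ℝ} (hPa : 0 ≤ Pa) :
    StrictMonoOn (S.rate Pa) (Set.Ici 0) := by
  intro x hx y hy hxy
  have hx : 0 ≤ x := hx
  have : 0 ≤ S.snr * Pa := by positivity
  have : 0 ≤ S.snr ^ 2 * x := by positivity
  have : S.snr ^ 2 * x < S.snr ^ 2 * y := by gcongr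
  exact log_div_two_lt (by linarith) (by linarith)

variable (S) in
/-- The largest product of the variances of a split of the power `Pa` that delivers at least `Pd`,
provided that `Pd ≤ PdcMax`. -/
def maxProduct (Pa Pd : ℝ) : ℝ := min (Pa ^ 2 / 4) ((S.PdcMax Pa - Pd) / (4 * (S.α + S.α')))

section Optimum
variable {Pa : ℝ} {F : Set (Measure ℂ)}

lemma deliveredPower_gaussianInput_of_add_eq {a b : ℝ} (ha : 0 ≤ a) (hb : 0 ≤ b)
    (hab : a + b = Pa) :
    S.deliveredPower (gaussianInput a b) = S.PdcMax Pa - 4 * (S.α + S.α') * (a * b) := by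
  rw [S.deliveredPower_gaussianInput ha hb, hab, PdcMax]; ring

/-- A product `D ≤ Pa² / 4` is realized by a split of `Pa`, the smaller part being the smaller root of
`x² - Pa x + D`. -/
lemma exists_split {D : ℝ} (hPa : 0 ≤ Pa) (h0 : 0 ≤ D) (hD : D ≤ Pa ^ 2 / 4) :
    ∃ x, 0 ≤ x ∧ x ≤ Pa / 2 ∧ (Pa - x) * x = D := by
  have hs : Real.sqrt (Pa ^ 2 / 4 - D) ^ 2 = Pa ^ 2 / 4 - D := Real.sq_sqrt (by linarith)
  refine ⟨Pa / 2 - Real.sqrt (Pa ^ 2 / 4 - D), ?_, ?_, ?_⟩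
  · have : Real.sqrt (Pa ^ 2 / 4 - D) ≤ Pa / 2 := Real.sqrt_le_iff.2 ⟨by linarith, by linarith⟩
    linarith
  · linarith [Real.sqrt_nonneg (Pa ^ 2 / 4 - D)]
  · linarith

lemma mul_le_sq_div_four {a b : ℝ} (ha : 0 ≤ a) (hb : 0 ≤ b) (hab : a + b ≤ Pa) :
    a * b ≤ Pa ^ 2 / 4 := by
  have : (a + b) ^ 2 ≤ Pa ^ 2 := by gcongr
  linarith [sq_nonneg (a - b)]

lemma maxProduct_nonneg (hα : 0 < S.α + S.α') {Pd : ℝ} (hPd : Pd ≤ S.PdcMax Pa) :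
    0 ≤ S.maxProduct Pa Pd :=
  le_min (by positivity) (div_nonneg (by linarith) (by linarith))

/-- For a given product `a * b`, the bound on the delivered power in `hd` increases with the input
power `P`; so the constraint on the product is weakest at `P = Pa`. -/
lemma le_maxProduct (hα : 0 < S.α + S.α') (hβ : 0 ≤ S.β + S.β') {Pd P a b : ℝ} (ha : 0 ≤ a)
    (hb : 0 ≤ b) (hab : a + b ≤ P) (hP : P ≤ Pa)
    (hd : Pd ≤ (S.α + S.α') * (3 * P ^ 2 - 4 * (a * b)) + (S.β + S.β') * P + S.γ) :
    a * b ≤ S.maxProduct Pa Pd := by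
  refine le_min (mul_le_sq_div_four ha hb (hab.trans hP)) ?_
  rw [le_div_iff₀ (by linarith), PdcMax]
  have h0 : 0 ≤ P := by linarith
  have h1 : (S.α + S.α') * P ^ 2 ≤ (S.α + S.α') * Pa ^ 2 := by gcongr
  have h2 : (S.β + S.β') * P ≤ (S.β + S.β') * Pa := by gcongr
  linarith

lemma gaussianInput_mem_feasible_iff (hF : SecondOrderClass F) {Pd a b : ℝ} (ha : 0 ≤ a)
    (hb : 0 ≤ b) : gaussianInput a b ∈ S.feasible F Pa Pd ↔
      a + b ≤ Pa ∧ Pd ≤ (S.α + S.α') * (3 * (a + b) ^ 2 - 4 * (a * b)) +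
        (S.β + S.β') * (a + b) + S.γ := by
  rw [feasible, Set.mem_ofPred_eq, inputPower_gaussianInput ha hb,
    S.deliveredPower_gaussianInput ha hb]
  exact and_iff_right (gaussianInput_mem hF a b)

lemma mem_feasible_of_mul_eq (hα : 0 < S.α + S.α') (hF : SecondOrderClass F) {Pd a b : ℝ}
    (ha : 0 ≤ a) (hb : 0 ≤ b) (hab : a + b = Pa) (h : a * b = S.maxProduct Pa Pd) :
    gaussianInput a b ∈ S.feasible F Pa Pd := by
  refine (gaussianInput_mem_feasible_iff hF ha hb).2 ⟨hab.le, ?_⟩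
  have : a * b ≤ _ := h.trans_le (min_le_right _ _)
  rw [le_div_iff₀ (by linarith), PdcMax] at this
  rw [hab]
  linarith

lemma mutualInfo_gaussianInput_eq_rate (hσ : 0 < S.noiseVar) {a b : ℝ} (ha : 0 ≤ a)
    (hb : 0 ≤ b) (hab : a + b = Pa) : S.mutualInfo (gaussianInput a b) = S.rate Pa (a * b) := by
  rw [S.mutualInfo_gaussianInput hσ ha hb, rate, ← hab]; ring_nf

theorem optimalRate_eq (hσ : 0 < S.noiseVar) (hρ : 0 < S.snr) (hα : 0 ≤ S.α) (hα' : 0 ≤ S.α')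
    (hαα : 0 < S.α + S.α') (hβ : 0 ≤ S.β + S.β') (hPa : 0 ≤ Pa) (hF : SecondOrderClass F)
    {Pd : ℝ} (hPd : Pd ≤ S.PdcMax Pa) :
    S.optimalRate F Pa Pd = S.rate Pa (S.maxProduct Pa Pd) := by
  apply le_antisymm
  · refine iSup₂_le fun p ⟨hp, hpP, hpd⟩ => ?_
    obtain ⟨a, b, ha, hb, hab, hd, hI⟩ := S.exists_bounds hσ hα hα' hF hp
    refine hI.trans (log_div_two_le ?_ ?_)
    · have : 0 ≤ S.snr * a := by positivity
      have : 0 ≤ S.snr * b := by positivity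
      nlinarith
    · have h1 : S.snr ^ 2 * (a * b) ≤ S.snr ^ 2 * S.maxProduct Pa Pd := by
        gcongr
        exact le_maxProduct hαα hβ ha hb hab hpP (hpd.trans hd)
      have h2 : S.snr * (a + b) ≤ S.snr * Pa := by
        gcongr
        exact hab.trans hpP
      linarith
  · obtain ⟨x, hx0, hx, hxD⟩ := exists_split hPa (maxProduct_nonneg hαα hPd) (min_le_left _ _)
    have hx1 : 0 ≤ Pa - x := by linarith
    rw [← hxD, ← mutualInfo_gaussianInput_eq_rate hσ hx1 hx0 (by ring)]
    exact le_iSup₂_of_le _ (mem_feasible_of_mul_eq hαα hF hx1 hx0 (by ring) hxD) le_rfl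

theorem isOptimal_gaussianInput_iff (hσ : 0 < S.noiseVar) (hρ : 0 < S.snr) (hα : 0 ≤ S.α)
    (hα' : 0 ≤ S.α') (hαα : 0 < S.α + S.α') (hβ : 0 ≤ S.β + S.β') (hPa : 0 ≤ Pa)
    (hF : SecondOrderClass F) {Pd : ℝ} (hPd : Pd ≤ S.PdcMax Pa) {a b : ℝ} (ha : 0 ≤ a)
    (hb : 0 ≤ b) :
    S.IsOptimal F Pa Pd (gaussianInput a b) ↔ a + b = Pa ∧ a * b = S.maxProduct Pa Pd := by
  rw [IsOptimal, optimalRate_eq hσ hρ hα hα' hαα hβ hPa hF hPd]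
  constructor
  · rintro ⟨hf, hI⟩
    obtain ⟨hab, hd⟩ := (gaussianInput_mem_feasible_iff hF ha hb).1 hf
    have hD := le_maxProduct hαα hβ ha hb le_rfl hab hd
    have h1 : 1 ≤ (1 + S.snr * a) * (1 + S.snr * b) := by
      have : 0 ≤ S.snr * a := by positivity
      have : 0 ≤ S.snr * b := by positivity
      nlinarith
    -- a strict loss of power or of product would be a strict loss of rate
    by_contra hne
    have hlt : (1 + S.snr * a) * (1 + S.snr * b) <
        1 + S.snr * Pa + S.snr ^ 2 * S.maxProduct Pa Pd := by
      have h2 : S.snr * (a + b) ≤ S.snr * Pa := by gcongr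
      have h3 : S.snr ^ 2 * (a * b) ≤ S.snr ^ 2 * S.maxProduct Pa Pd := by gcongr
      rcases hab.lt_or_eq with h | h
      · have : S.snr * (a + b) < S.snr * Pa := by gcongr
        linarith
      · have hlt := hD.lt_of_ne fun h' => hne ⟨h, h'⟩
        have : S.snr ^ 2 * (a * b) < S.snr ^ 2 * S.maxProduct Pa Pd := by gcongr
        linarith
    rw [S.mutualInfo_gaussianInput hσ ha hb] at hI
    exact (log_div_two_lt h1 hlt).ne hI
  · rintro ⟨hab, hD⟩
    exact ⟨mem_feasible_of_mul_eq hαα hF ha hb hab hD,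
      by rw [mutualInfo_gaussianInput_eq_rate hσ ha hb hab, hD]⟩

end Optimum

end System

end SWIPT

end

theorem proposition2 (S : SWIPT.System) (hk₂ : 0 ≤ S.k₂) (hk₄ : 0 < S.k₄) (hfw : 0 < S.fw)
    (hσw : 0 < S.σw) (hh : S.h ≠ 0) (Pa : ℝ) (hPa : 0 < Pa)
    (F : Set (MeasureTheory.Measure ℂ)) (hF : SWIPT.SecondOrderClass F) :
    -- the fourth-order statistics of the zero-mean Gaussian inputs
    (∀ Pr Pi : ℝ, 0 ≤ Pr → 0 ≤ Pi →
      SWIPT.momentQ (SWIPT.gaussianInput Pr Pi) = 3 * (Pi ^ 2 + Pr ^ 2) + 2 * Pi * Pr ∧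
      SWIPT.momentQt (SWIPT.gaussianInput Pr Pi) = 3 * (Pi ^ 2 + Pr ^ 2) + 2 * Pi * Pr) ∧
    -- the supremum is achieved by a zero-mean Gaussian input with full power, whenever `Pd` can be
    -- delivered at all
    (∀ Pd : ℝ, Pd ≤ S.PdcMax Pa → ∃ Pr Pi : ℝ, 0 ≤ Pr ∧ 0 ≤ Pi ∧ Pr + Pi = Pa ∧
      S.IsOptimal F Pa Pd (SWIPT.gaussianInput Pr Pi)) ∧
    -- the maximum delivered power in the class
    IsGreatest {d : ℝ | ∃ p ∈ F, SWIPT.inputPower p ≤ Pa ∧ S.deliveredPower p = d}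
      (S.PdcMax Pa) ∧
    -- the range of the delivered power over the power splits, and where its ends are attained
    {d : ℝ | ∃ Pr Pi : ℝ, 0 ≤ Pr ∧ 0 ≤ Pi ∧ Pr + Pi = Pa ∧
      S.deliveredPower (SWIPT.gaussianInput Pr Pi) = d} = Set.Icc (S.PdcMin Pa) (S.PdcMax Pa) ∧
    (∀ Pr Pi : ℝ, 0 ≤ Pr → 0 ≤ Pi → Pr + Pi = Pa →
      ((S.deliveredPower (SWIPT.gaussianInput Pr Pi) = S.PdcMax Pa ↔
          (Pi = 0 ∧ Pr = Pa) ∨ (Pi = Pa ∧ Pr = 0)) ∧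
        (S.deliveredPower (SWIPT.gaussianInput Pr Pi) = S.PdcMin Pa ↔
          Pi = Pa / 2 ∧ Pr = Pa / 2))) ∧
    -- `Pd = PdcMax`
    (∀ Pr Pi : ℝ, 0 ≤ Pr → 0 ≤ Pi →
      (S.IsOptimal F Pa (S.PdcMax Pa) (SWIPT.gaussianInput Pr Pi) ↔
        (Pi = 0 ∧ Pr = Pa) ∨ (Pi = Pa ∧ Pr = 0))) ∧
    -- `Pd ≤ PdcMin`
    (∀ Pd : ℝ, Pd ≤ S.PdcMin Pa → ∀ Pr Pi : ℝ, 0 ≤ Pr → 0 ≤ Pi →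
      (S.IsOptimal F Pa Pd (SWIPT.gaussianInput Pr Pi) ↔ Pi = Pa / 2 ∧ Pr = Pa / 2)) ∧
    -- `PdcMin < Pd < PdcMax`
    (∀ Pd : ℝ, S.PdcMin Pa < Pd → Pd < S.PdcMax Pa →
      (∀ Pr Pi : ℝ, 0 ≤ Pr → 0 ≤ Pi →
        (S.IsOptimal F Pa Pd (SWIPT.gaussianInput Pr Pi) ↔
          Pr + Pi = Pa ∧
          S.α * SWIPT.momentQ (SWIPT.gaussianInput Pr Pi)
            + S.α' * SWIPT.momentQt (SWIPT.gaussianInput Pr Pi)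
            + (S.β + S.β') * Pa + S.γ = Pd)) ∧
      (∃ Pi : ℝ, 0 < Pi ∧ Pi < Pa / 2 ∧
        S.IsOptimal F Pa Pd (SWIPT.gaussianInput (Pa - Pi) Pi))) ∧
    -- the tradeoff
    StrictAntiOn (fun Pd : ℝ => S.optimalRate F Pa Pd)
      (Set.Icc (S.PdcMin Pa) (S.PdcMax Pa)) := by
  have hσ : 0 < S.noiseVar := by rw [SWIPT.System.noiseVar]; positivity
  have hn : 0 < ‖S.h‖ := norm_pos_iff.2 hh
  have hρ : 0 < S.snr := by rw [SWIPT.System.snr]; positivity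
  have hα0 : 0 < S.α := by rw [SWIPT.System.α]; positivity
  have hα' : 0 ≤ S.α' := by rw [SWIPT.System.α']; positivity
  have hβ : 0 ≤ S.β + S.β' := by rw [SWIPT.System.β, SWIPT.System.β']; positivity
  have hα : 0 < S.α + S.α' := by linarith
  have hopt {Pd : ℝ} (hPd : Pd ≤ S.PdcMax Pa) {a b : ℝ} (ha : 0 ≤ a) (hb : 0 ≤ b) :=
    SWIPT.System.isOptimal_gaussianInput_iff hσ hρ hα0.le hα' hα hβ hPa.le hF hPd ha hb
  have hdel {a b : ℝ} (ha : 0 ≤ a) (hb : 0 ≤ b) (hab : a + b = Pa) :=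
    SWIPT.System.deliveredPower_gaussianInput_of_add_eq (S := S) ha hb hab
  have hmin : S.PdcMin Pa = S.PdcMax Pa - (S.α + S.α') * Pa ^ 2 := by
    rw [SWIPT.System.PdcMin, SWIPT.System.PdcMax]; ring
  have hminmax : S.PdcMin Pa ≤ S.PdcMax Pa := by
    rw [hmin]; have : 0 ≤ (S.α + S.α') * Pa ^ 2 := by positivity
    linarith
  have hprod0 {a b : ℝ} (hab : a + b = Pa) :
      a * b = 0 ↔ (b = 0 ∧ a = Pa) ∨ (b = Pa ∧ a = 0) := by
    constructor
    · intro h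
      rcases mul_eq_zero.1 h with h | h
      · exact Or.inr ⟨by linarith, h⟩
      · exact Or.inl ⟨h, by linarith⟩
    · rintro (⟨h, -⟩ | ⟨-, h⟩) <;> simp [h]
  have hprodmax {a b : ℝ} (hab : a + b = Pa) :
      a * b = Pa ^ 2 / 4 ↔ b = Pa / 2 ∧ a = Pa / 2 := by
    constructor
    · intro h
      have h0 : (a - b) ^ 2 = 0 := by rw [← hab] at h; linarith
      have h1 : a - b = 0 := by simpa using h0
      constructor <;> linarith
    · rintro ⟨rfl, rfl⟩; ring
  have hDmax : S.maxProduct Pa (S.PdcMax Pa) = 0 := by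
    rw [SWIPT.System.maxProduct, sub_self, zero_div]; exact min_eq_right (by positivity)
  have hDlow {Pd : ℝ} (h : Pd ≤ S.PdcMin Pa) : S.maxProduct Pa Pd = Pa ^ 2 / 4 := by
    refine min_eq_left ?_
    rw [le_div_iff₀ (by linarith)]; linarith
  have hDhigh {Pd : ℝ} (h : S.PdcMin Pa ≤ Pd) :
      S.maxProduct Pa Pd = (S.PdcMax Pa - Pd) / (4 * (S.α + S.α')) := by
    refine min_eq_right ?_
    rw [div_le_iff₀ (by linarith)]; linarith
  have hQ {a b : ℝ} (ha : 0 ≤ a) (hb : 0 ≤ b) (hab : a + b = Pa) :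
      S.α * SWIPT.momentQ (SWIPT.gaussianInput a b)
        + S.α' * SWIPT.momentQt (SWIPT.gaussianInput a b) + (S.β + S.β') * Pa + S.γ =
      S.PdcMax Pa - 4 * (S.α + S.α') * (a * b) := by
    rw [← hdel ha hb hab, SWIPT.System.deliveredPower, SWIPT.inputPower_gaussianInput ha hb, hab]
  refine ⟨?_, ?_, ⟨?_, ?_⟩, ?_, ?_, ?_, ?_, ?_, ?_⟩
  · intro a b ha hb
    rw [SWIPT.momentQ_gaussianInput ha hb, SWIPT.momentQt_gaussianInput ha hb]
    constructor <;> ring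
  · intro Pd hPd
    obtain ⟨x, hx0, hx, hxD⟩ := SWIPT.System.exists_split hPa.le
      (SWIPT.System.maxProduct_nonneg hα hPd) (min_le_left _ _)
    have hx1 : 0 ≤ Pa - x := by linarith
    exact ⟨Pa - x, x, hx1, hx0, by ring, (hopt hPd hx1 hx0).2 ⟨by ring, hxD⟩⟩
  · refine ⟨_, SWIPT.System.gaussianInput_mem hF Pa 0, ?_, ?_⟩
    · rw [SWIPT.inputPower_gaussianInput hPa.le le_rfl, add_zero]
    · rw [hdel hPa.le le_rfl (add_zero _)]; ring
  · rintro d ⟨p, hp, hP, rfl⟩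
    obtain ⟨a, b, ha, hb, hab, hd, -⟩ := S.exists_bounds hσ hα0.le hα' hF hp
    have h1 := SWIPT.System.le_maxProduct hα hβ ha hb hab hP hd
    have h2 : a * b ≤ _ := h1.trans (min_le_right _ _)
    rw [le_div_iff₀ (by linarith)] at h2
    have h3 : 0 ≤ a * b * (4 * (S.α + S.α')) := by positivity
    linarith
  · ext d
    constructor
    · rintro ⟨a, b, ha, hb, hab, rfl⟩
      rw [hdel ha hb hab, hmin]
      have h1 : (S.α + S.α') * (a * b) ≤ (S.α + S.α') * (Pa ^ 2 / 4) := by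
        gcongr
        exact SWIPT.System.mul_le_sq_div_four ha hb hab.le
      have h2 : 0 ≤ (S.α + S.α') * (a * b) := by positivity
      constructor <;> linarith
    · rintro ⟨h1, h2⟩
      obtain ⟨x, hx0, hx, hxD⟩ := SWIPT.System.exists_split hPa.le
        (SWIPT.System.maxProduct_nonneg hα h2) (min_le_left _ _)
      have hx1 : 0 ≤ Pa - x := by linarith
      refine ⟨Pa - x, x, hx1, hx0, by ring, ?_⟩
      rw [hdel hx1 hx0 (by ring), hxD, hDhigh h1]
      field_simp
      ring
  · intro a b ha hb hab
    rw [hdel ha hb hab, hmin, ← hprod0 hab, ← hprodmax hab]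
    constructor <;> constructor <;> intro h
    · have : 4 * (S.α + S.α') * (a * b) = 0 := by linarith
      simpa [hα.ne'] using this
    · rw [h]; ring
    · have : (S.α + S.α') * (a * b) = (S.α + S.α') * (Pa ^ 2 / 4) := by linarith
      exact mul_left_cancel₀ hα.ne' this
    · rw [h]; ring
  · intro a b ha hb
    rw [hopt le_rfl ha hb, hDmax]
    refine ⟨fun ⟨h1, h2⟩ => (hprod0 h1).1 h2, fun h => ?_⟩
    have hab : a + b = Pa := by rcases h with ⟨h, h'⟩ | ⟨h, h'⟩ <;> linarith
    exact ⟨hab, (hprod0 hab).2 h⟩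
  · intro Pd hPd a b ha hb
    rw [hopt (hPd.trans hminmax) ha hb, hDlow hPd]
    refine ⟨fun ⟨h1, h2⟩ => (hprodmax h1).1 h2, fun h => ?_⟩
    have hab : a + b = Pa := by linarith [h.1, h.2]
    exact ⟨hab, (hprodmax hab).2 h⟩
  · intro Pd h1 h2
    refine ⟨fun a b ha hb => ?_, ?_⟩
    · rw [hopt h2.le ha hb, hDhigh h1.le, eq_div_iff (by linarith)]
      refine and_congr_right fun hab => ?_
      rw [hQ ha hb hab]
      constructor <;> intro h <;> linarith
    · obtain ⟨x, hx0, hx, hxD⟩ := SWIPT.System.exists_split hPa.le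
        (SWIPT.System.maxProduct_nonneg hα h2.le) (min_le_left _ _)
      have hx1 : 0 ≤ Pa - x := by linarith
      -- `x = 0` would deliver `PdcMax` and `x = Pa / 2` would deliver `PdcMin`
      have hpd := hdel hx1 hx0 (by ring)
      rw [hxD, hDhigh h1.le, mul_div_cancel₀ _ (by linarith)] at hpd
      have hpd' := hdel hx1 hx0 (by ring)
      refine ⟨x, hx0.lt_of_ne' ?_, hx.lt_of_ne ?_, (hopt h2.le hx1 hx0).2 ⟨by ring, hxD⟩⟩
      · rintro rfl
        rw [mul_zero, mul_zero] at hpd'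
        linarith
      · rintro rfl
        rw [hpd, show (Pa - Pa / 2) * (Pa / 2) = Pa ^ 2 / 4 by ring] at hpd'
        linarith
  · intro x hx y hy hxy
    have hrate {Pd : ℝ} (h : Pd ≤ S.PdcMax Pa) :=
      SWIPT.System.optimalRate_eq hσ hρ hα0.le hα' hα hβ hPa.le hF h
    simp only [hrate hx.2, hrate hy.2]
    refine SWIPT.System.rate_strictMonoOn hρ hPa.le (SWIPT.System.maxProduct_nonneg hα hy.2)
      (SWIPT.System.maxProduct_nonneg hα hx.2) ?_
    rw [hDhigh hx.1, hDhigh hy.1]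
    gcongr
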